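/- For $n\ge 1$ let $t=(1,-1)$ and $s_k=(k,k+1)(-k,-k-1)$ ($1\le k\le n-1$), as permutations of $\{\pm1,\dots,\pm n\}$. Let $S_n'=\{s_1'=ts_1t,\;s_1,\dots,s_{n-1}\}$ (so $S_1'=\varnothing$) and let $W_n'$ be the group generated by $S_n'$; for $n\ge 3$, $(W_n',S_n')$ is the Coxeter group of type $D_n$. Let $\ell$ be its length function with respect to $S_n'$. For $I\subseteq S_n'$ put $$X_I=\{w\in W_n' : \ell(ws)>\ell(w)\text{ for all } s\in I\},\qquad x_I=\sum_{w\in X_I}w\in\mathbb{Q}W_n',$$ and let $\Sigma(W_n')$ be the linear span of the elements $x_I$ $(I\subseteq S_n')$ in $\mathbb{Q}W_n'$. It is a unital subalgebra of $\mathbb{Q}W_n'$ (Solomon's descent algebra), that is, it equals the subalgebra generated by the $x_I$. Let $\sigma_n$ be the automorphism $w\mapsto twt^{-1}$ of $W_n'$, which stabilizes $S_n'$, and let $\Sigma(W_n')^{\sigma_n}$ be the subalgebra of the elements of $\Sigma(W_n')$ fixed by $\sigma_n$. For a finite dimensional $\mathbb{Q}$-algebra $A$ with radical $\operatorname{Rad}A$,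 let $\mathrm{LL}(A)$ denote its Loewy length, the smallest integer $k\ge 1$ such that $(\operatorname{Rad}A)^k=0$. Then: (a) if $n\ge 3$ is even, then $\mathrm{LL}(\Sigma(W_n'))=n/2$; (b) if $n\ge 3$ is odd, then $\mathrm{LL}(\Sigma(W_n'))\ge (n+3)/2$; (c) for every $n\ge 1$, $\mathrm{LL}(\Sigma(W_n')^{\sigma_n})=\lceil n/2\rceil$. -/

import Mathlib

/-! Descent algebras, Loewy length, and the Coxeter groups of type `D`. -/

namespace DescentAlg

section General

variable {W : Type*} [Group W]

/-- The length `ℓ(w)` of `w` with respect to a generating set `S` of involutions: the least number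
of factors in an expression of `w` as a product of elements of `S`. -/
noncomputable def length (S : Set W) (w : W) : ℕ :=
  sInf {k : ℕ | ∃ l : List W, (∀ s ∈ l, s ∈ S) ∧ l.prod = w ∧ l.length = k}

/-- `X_I = {w ∈ W | ws > w for all s ∈ I}`. For a simple reflection `s`, the elements `ws` and `w`
are comparable in the Bruhat order, and `ws > w` means `ℓ(ws) > ℓ(w)`. -/
def minReps (S I : Set W) : Set W :=
  {w | ∀ s ∈ I, length S w < length S (w * s)}

variable [Fintype W]

open Classical in
/-- `x_I = ∑_{w ∈ X_I} w`, an element of the group algebra `ℚW`. -/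
noncomputable def xElt (S I : Set W) : MonoidAlgebra ℚ W :=
  ∑ w : W with w ∈ minReps S I, MonoidAlgebra.of ℚ W w

/-- The linear span of the elements `x_I`, for `I ⊆ S`, in `ℚW`. -/
noncomputable def descentSpace (S : Set W) : Submodule ℚ (MonoidAlgebra ℚ W) :=
  Submodule.span ℚ {a | ∃ I ⊆ S, a = xElt S I}

/-- The descent algebra `Σ(W)` as a unital subalgebra of `ℚW`: the subalgebra generated by the
elements `x_I`, `I ⊆ S`. By a theorem of Solomon it is just their linear span
`descentSpace S` when `(W, S)` is a finite Coxeter group. -/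
noncomputable def descentAlgebra (S : Set W) : Subalgebra ℚ (MonoidAlgebra ℚ W) :=
  Algebra.adjoin ℚ {a | ∃ I ⊆ S, a = xElt S I}

/-- The subalgebra `Σ(W)^σ` of the elements of `Σ(W)` fixed by (the linear extension to `ℚW` of)
an automorphism `σ` of `W`. -/
noncomputable def fixedDescentAlgebra (S : Set W) (σ : MulAut W) :
    Subalgebra ℚ (MonoidAlgebra ℚ W) :=
  descentAlgebra S ⊓
    AlgHom.equalizer (MonoidAlgebra.domCongr ℚ ℚ σ : MonoidAlgebra ℚ W →ₐ[ℚ] MonoidAlgebra ℚ W)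
      (AlgHom.id ℚ (MonoidAlgebra ℚ W))

end General

/-- The Loewy length of a finite dimensional algebra `A`: the smallest `k ≥ 1` such that
`(Rad A)^k = 0`. -/
noncomputable def loewyLength (A : Type*) [Ring A] : ℕ :=
  sInf {k : ℕ | 1 ≤ k ∧ Ring.jacobson A ^ k = ⊥}

section TypeD

/-- The set `{±1, …, ±n}`: the pair `(i, ε)` stands for `ε (i + 1)`. -/
abbrev SignedIdx (n : ℕ) : Type := Fin n × ℤˣ

/-- The permutation `t = (1, -1)` of `{±1, …, ±n}`. -/
def t (n : ℕ) : Equiv.Perm (SignedIdx n) :=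
  Function.Involutive.toPerm (fun p => if p.1.val = 0 then (p.1, -p.2) else p) (by
    rintro ⟨i, e⟩
    by_cases h : i.val = 0 <;> simp [h])

/-- The permutation of `{±1, …, ±n}` that exchanges `i` and `j`, as well as `-i` and `-j`. -/
def s {n : ℕ} (i j : Fin n) : Equiv.Perm (SignedIdx n) :=
  Equiv.prodCongr (Equiv.swap i j) (Equiv.refl ℤˣ)

/-- The set `S'_n = {s'_1, s_1, …, s_{n-1}}`, where `s_k = (k, k+1)(-k, -k-1)` and
`s'_1 = t s_1 t`. It is empty for `n = 1`. -/
def simpleD (n : ℕ) : Set (Equiv.Perm (SignedIdx n)) :=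
  {w | ∃ i j : Fin n, i.val + 1 = j.val ∧ (w = s i j ∨ (i.val = 0 ∧ w = t n * s i j * t n))}

/-- The group `W'_n` generated by `S'_n`, the Coxeter group of type `D_n`. -/
def weylD (n : ℕ) : Subgroup (Equiv.Perm (SignedIdx n)) :=
  Subgroup.closure (simpleD n)

noncomputable instance weylDFintype (n : ℕ) : Fintype (weylD n) :=
  Fintype.ofFinite _

/-- The set `S'_n` as a set of elements of `W'_n`. -/
def gensD (n : ℕ) : Set (weylD n) :=
  {w | (w : Equiv.Perm (SignedIdx n)) ∈ simpleD n}

theorem t_apply {n : ℕ} (p : SignedIdx n) :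
    t n p = if p.1.val = 0 then (p.1, -p.2) else p := rfl

theorem s_apply {n : ℕ} (i j : Fin n) (p : SignedIdx n) :
    s i j p = (Equiv.swap i j p.1, p.2) := rfl

theorem t_mul_t (n : ℕ) : t n * t n = 1 := by
  ext1 p
  exact (t n).left_inv p

theorem t_conj_simpleD {n : ℕ} {w : Equiv.Perm (SignedIdx n)} (hw : w ∈ simpleD n) :
    t n * w * t n ∈ simpleD n := by
  obtain ⟨i, j, hij, h⟩ := hw
  refine ⟨i, j, hij, ?_⟩
  by_cases hi : i.val = 0
  · rcases h with rfl | ⟨-, rfl⟩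
    · exact Or.inr ⟨hi, rfl⟩
    · left
      calc t n * (t n * s i j * t n) * t n = (t n * t n) * s i j * (t n * t n) := by group
        _ = s i j := by rw [t_mul_t, one_mul, mul_one]
  · rcases h with rfl | ⟨h0, -⟩
    · left
      have key : t n * s i j = s i j * t n := by
        ext1 ⟨k, e⟩
        have hj : j.val ≠ 0 := by omega
        have hk : (Equiv.swap i j k).val = 0 ↔ k.val = 0 := by
          by_cases h1 : k = i
          · subst h1; simp [hi, hj]
          · by_cases h2 : k = j
            · subst h2; simp [hi, hj]
            · rw [Equiv.swap_apply_of_ne_of_ne h1 h2]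
        by_cases h3 : k.val = 0 <;> simp [Equiv.Perm.mul_apply, t_apply, s_apply, hk, h3]
      rw [key, mul_assoc, t_mul_t, mul_one]
    · exact absurd h0 hi

theorem t_inv (n : ℕ) : (t n)⁻¹ = t n := inv_eq_of_mul_eq_one_left (t_mul_t n)

theorem t_conj_weylD {n : ℕ} {w : Equiv.Perm (SignedIdx n)} (hw : w ∈ weylD n) :
    t n * w * (t n)⁻¹ ∈ weylD n := by
  have h : weylD n ≤ (weylD n).comap (MulAut.conj (t n)).toMonoidHom := by
    refine (Subgroup.closure_le _).2 fun x hx => ?_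
    have hx' : t n * x * (t n)⁻¹ ∈ simpleD n := by
      rw [t_inv]; exact t_conj_simpleD hx
    exact Subgroup.subset_closure hx'
  exact h hw

theorem t_mem_normalizer (n : ℕ) :
    t n ∈ Subgroup.normalizer (weylD n : Set (Equiv.Perm (SignedIdx n))) := by
  refine Subgroup.mem_normalizer_iff.2 fun w => ⟨fun hw => t_conj_weylD hw, fun hw => ?_⟩
  have h := t_conj_weylD hw
  have e : t n * (t n * w * (t n)⁻¹) * (t n)⁻¹ = w := by
    rw [t_inv]
    calc t n * (t n * w * t n) * t n = (t n * t n) * w * (t n * t n) := by group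
      _ = w := by rw [t_mul_t, one_mul, mul_one]
  rwa [e] at h

/-- The automorphism `σ_n : w ↦ t w t⁻¹` of `W'_n`. It exchanges `s_1` and `s'_1` and fixes the
other elements of `S'_n`. -/
def sigmaD (n : ℕ) : MulAut (weylD n) :=
  (weylD n).normalizerMonoidHom ⟨t n, t_mem_normalizer n⟩

theorem coe_sigmaD_apply (n : ℕ) (w : weylD n) :
    (sigmaD n w : Equiv.Perm (SignedIdx n)) = t n * w * (t n)⁻¹ := rfl

end TypeD

end DescentAlg

/-! The group is realised as the signed permutations of parity one, and lengths are counted by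
inversions. Write `x_J` for `ascSum J`, the sum of all `w` keeping the simple roots in `J` positive.
If `f` is a dominant vector vanishing exactly on the simple roots in `J`, the elements of `X_J`
correspond to the orbit of `f`. This yields Solomon's theorem in the form `ascSum_mul_ascSum`: the
product `x_J x_I` is a sum of elements `x_K` with `K ⊆ I`. So left multiplication is triangular on
the `x_I`, and the radical of any subalgebra consists of its elements with zero diagonal
(`mem_jacobson_iff`). In particular, every commutator that belongs to the subalgebra is in its
radical.

Upper bound. The longest element `w₀` lies in the descent algebra, and by inclusion-exclusion it
acts on the layer spanned by the `x_K` with `|K| = j`, modulo smaller sets, as `(-1)^j`. A radical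
element commuting with `w₀` preserves the eigenspaces of `w₀`, so on a suitable eigenvector it goes
down by two layers instead of one. Applied to the two eigencomponents of `1`, this puts a product of
`(n + 1) / 2` radical elements into the line of `x_∅`, which meets the radical only in zero because
`x_∅² = |W| x_∅` (`jacobson_pow_eq_bot`). For even `n`, `w₀ = -1` is central; for odd `n`,
conjugation by `w₀` is `σ_n`, so `w₀` commutes with the fixed subalgebra.

Lower bounds. Products are shown to be nonzero in the reflection representation, realised on odd
functions of the signed indices. On the vectors `l ↦ C(l, k)`, `k ≥ 1`, the element of the vector
`(0, …, 0, 1)` is diagonal with distinct eigenvalues, while the sum of the elements of `(±1, 1, …,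
1)` is triangular and involves only odd lower terms. Their commutator `lowering n` is a fixed
radical element that takes an odd `k ≥ 3` to a nonzero multiple of `k - 2`, up to lower odd terms.
Descending from the largest odd `k < n` settles even `n`. For odd `n`, the difference `signDiff n`
of the elements of `(±1, 1, …, 1)` also lies in the radical, and two applications of it reach a
vector with leading term `k = n - 2`. This adds two factors in the full algebra, whereas the fixed
algebra sees only the square of `signDiff n` and gains one. -/

namespace DescentAlg

/-! ### Signed permutations, simple reflections and inversions. -/

section SignedPermutations

variable {n : ℕ}

/-- The negative of a signed index. -/
def neg (x : SignedIdx n) : SignedIdx n := (x.1, -x.2)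

@[simp] theorem neg_neg_idx (x : SignedIdx n) : neg (neg x) = x := by simp [neg]

@[simp] theorem neg_fst (x : SignedIdx n) : (neg x).1 = x.1 := rfl

@[simp] theorem neg_snd (x : SignedIdx n) : (neg x).2 = -x.2 := rfl

theorem neg_ne_self (x : SignedIdx n) : neg x ≠ x := by
  intro h
  have := congrArg Prod.snd h
  rcases Int.units_eq_one_or x.2 with h' | h' <;> simp [h'] at this

theorem fst_eq_iff {x y : SignedIdx n} : x.1 = y.1 ↔ x = y ∨ x = neg y := by
  constructor
  · intro h
    rcases Int.units_eq_one_or x.2 with hx | hx <;> rcases Int.units_eq_one_or y.2 with hy | hy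
    · left; exact Prod.ext h (hx.trans hy.symm)
    · right; exact Prod.ext h (by simp [hx, hy])
    · right; exact Prod.ext h (by simp [hx, hy])
    · left; exact Prod.ext h (hx.trans hy.symm)
  · rintro (rfl | rfl) <;> rfl

/-- A permutation of the signed indices is signed if it commutes with the negation. -/
def IsSigned (w : Equiv.Perm (SignedIdx n)) : Prop := ∀ x, w (neg x) = neg (w x)

/-- The product of the signs of the values of `w` at the positive indices. -/
def parity (w : Equiv.Perm (SignedIdx n)) : ℤˣ := ∏ i : Fin n, (w (i, 1)).2

theorem IsSigned.mul {v w : Equiv.Perm (SignedIdx n)} (hv : IsSigned v) (hw : IsSigned w) :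
    IsSigned (v * w) := fun x => by simp [Equiv.Perm.mul_apply, hw x, hv (w x)]

theorem IsSigned.inv {w : Equiv.Perm (SignedIdx n)} (hw : IsSigned w) : IsSigned w⁻¹ := fun x => by
  apply w.injective
  rw [hw]
  simp

theorem IsSigned.fst_eq_iff {w : Equiv.Perm (SignedIdx n)} (hw : IsSigned w) (x y : SignedIdx n) :
    (w x).1 = (w y).1 ↔ x.1 = y.1 := by
  rw [DescentAlg.fst_eq_iff, DescentAlg.fst_eq_iff, ← hw, w.injective.eq_iff, w.injective.eq_iff]

theorem IsSigned.snd_apply {w : Equiv.Perm (SignedIdx n)} (hw : IsSigned w) (x : SignedIdx n) :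
    (w x).2 = (w (x.1, 1)).2 * x.2 := by
  obtain ⟨i, e⟩ := x
  rcases Int.units_eq_one_or e with rfl | rfl
  · simp
  · have := hw (i, 1)
    simp only [neg] at this
    simp [this]

theorem IsSigned.fst_apply {w : Equiv.Perm (SignedIdx n)} (hw : IsSigned w) (x : SignedIdx n) :
    (w x).1 = (w (x.1, 1)).1 := (hw.fst_eq_iff _ _).2 rfl

/-- The permutation of the absolute values underlying a signed permutation. -/
noncomputable def IsSigned.perm {w : Equiv.Perm (SignedIdx n)} (hw : IsSigned w) :
    Equiv.Perm (Fin n) :=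
  Equiv.ofBijective (fun i => (w (i, 1)).1)
    (Finite.injective_iff_bijective.1 fun i j h => (hw.fst_eq_iff (i, 1) (j, 1)).1 h)

theorem IsSigned.perm_apply {w : Equiv.Perm (SignedIdx n)} (hw : IsSigned w) (i : Fin n) :
    hw.perm i = (w (i, 1)).1 := rfl

/-- The signs contributed by `v` are only read in the order given by the underlying permutation of
`w`. -/
theorem parity_mul {v w : Equiv.Perm (SignedIdx n)} (hv : IsSigned v) (hw : IsSigned w) :
    parity (v * w) = parity v * parity w := by
  have h : ∀ i, ((v * w) (i, 1)).2 = (v (hw.perm i, 1)).2 * (w (i, 1)).2 := fun i => by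
    rw [Equiv.Perm.mul_apply, hv.snd_apply, hw.perm_apply]
  simp only [parity, h, Finset.prod_mul_distrib]
  rw [Equiv.prod_comp hw.perm fun i => (v (i, 1)).2]

theorem isSigned_one : IsSigned (1 : Equiv.Perm (SignedIdx n)) := fun _ => rfl

theorem parity_one : parity (1 : Equiv.Perm (SignedIdx n)) = 1 := by simp [parity]

theorem isSigned_t : IsSigned (t n) := fun x => by
  by_cases h : x.1.val = 0 <;> simp [t_apply, h, neg]

theorem isSigned_s (i j : Fin n) : IsSigned (s i j) := fun x => by simp [s_apply, neg]

theorem parity_s (i j : Fin n) : parity (s i j) = 1 := by simp [parity, s_apply]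

theorem parity_t (hn : 0 < n) : parity (t n) = -1 := by
  have : ∀ i : Fin n, (t n (i, 1)).2 = if i = ⟨0, hn⟩ then -1 else 1 := fun i => by
    by_cases h : i.val = 0 <;> simp [t_apply, h, Fin.ext_iff]
  simp [parity, this]

theorem parity_t_mul_self : parity (t n) * parity (t n) = 1 := by
  rw [← parity_mul isSigned_t isSigned_t, t_mul_t, parity_one]

theorem isSigned_of_mem_simpleD {w : Equiv.Perm (SignedIdx n)} (hw : w ∈ simpleD n) :
    IsSigned w ∧ parity w = 1 := by
  obtain ⟨i, j, -, rfl | ⟨-, rfl⟩⟩ := hw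
  · exact ⟨isSigned_s i j, parity_s i j⟩
  · refine ⟨(isSigned_t.mul (isSigned_s i j)).mul isSigned_t, ?_⟩
    rw [parity_mul (isSigned_t.mul (isSigned_s i j)) isSigned_t,
      parity_mul isSigned_t (isSigned_s i j), parity_s, mul_one, parity_t_mul_self]

theorem isSigned_of_mem_weylD {w : Equiv.Perm (SignedIdx n)} (hw : w ∈ weylD n) :
    IsSigned w ∧ parity w = 1 := by
  induction hw using Subgroup.closure_induction with
  | mem x hx => exact isSigned_of_mem_simpleD hx
  | one => exact ⟨isSigned_one, parity_one⟩
  | mul x y _ _ hx hy => exact ⟨hx.1.mul hy.1, by rw [parity_mul hx.1 hy.1, hx.2, hy.2, mul_one]⟩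
  | inv x _ hx =>
    refine ⟨hx.1.inv, ?_⟩
    have := parity_mul hx.1.inv hx.1
    rwa [inv_mul_cancel, parity_one, hx.2, mul_one, eq_comm] at this

/-- The value of a signed index under a generic dominant vector. -/
def rho (x : SignedIdx n) : ℤ := (x.2 : ℤ) * (x.1.val : ℤ)

/-- A function on the signed indices is odd if it changes its sign under the negation. -/
def IsOdd {R : Type*} [Neg R] (f : SignedIdx n → R) : Prop := ∀ x, f (neg x) = -f x

theorem isOdd_rho : IsOdd (rho (n := n)) := fun x => by simp [rho]

theorem IsOdd.comp {R : Type*} [Neg R] {f : SignedIdx n → R} (hf : IsOdd f)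
    {w : Equiv.Perm (SignedIdx n)} (hw : IsSigned w) : IsOdd (fun x => f (w x)) := fun x => by
  simp only [hw x]; exact hf _

@[simp] theorem rho_pos (i : Fin n) : rho (i, 1) = i.val := by simp [rho]

@[simp] theorem rho_neg (i : Fin n) : rho (i, -1) = -(i.val : ℤ) := by simp [rho]

theorem rho_ne {x y : SignedIdx n} (h : x.1 ≠ y.1) : rho x ≠ rho y := by
  obtain ⟨i, e⟩ := x
  obtain ⟨j, e'⟩ := y
  have h' : i.val ≠ j.val := fun h' => h (Fin.ext h')
  rcases Int.units_eq_one_or e with rfl | rfl <;> rcases Int.units_eq_one_or e' with rfl | rfl <;>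
    simp <;> omega

/-- The labels of the simple roots: the label `p` stands for the root that takes an odd function
`f` to `f (up p) - f p`. -/
abbrev SimpleIdx (n : ℕ) : Type :=
  {p : SignedIdx n // p.1.val + 1 < n ∧ (p.2 = 1 ∨ p.1.val = 0)}

/-- The second index occurring in the simple root `p`. -/
def up (p : SimpleIdx n) : SignedIdx n := (⟨p.1.1.val + 1, p.2.1⟩, 1)

theorem rho_up (p : SimpleIdx n) : rho (up p) = rho p.1 + 1 := by
  obtain ⟨⟨i, e⟩, h1, h2⟩ := p
  rcases h2 with h2 | h2
  · simp only at h2; subst h2; simp [up]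
  · simp only at h2; simp [up, rho, h2]

theorem fst_ne_up (p : SimpleIdx n) : p.1.1 ≠ (up p).1 := by
  intro h
  have := congrArg Fin.val h
  simp [up] at this

/-- The reflection in the simple root `p`. -/
def refl (p : SimpleIdx n) : Equiv.Perm (SignedIdx n) :=
  if p.1.2 = 1 then s p.1.1 (up p).1 else t n * s p.1.1 (up p).1 * t n

theorem mem_simpleD_iff {w : Equiv.Perm (SignedIdx n)} :
    w ∈ simpleD n ↔ ∃ p, refl p = w := by
  constructor
  · rintro ⟨i, j, hij, rfl | ⟨hi, rfl⟩⟩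
    · refine ⟨⟨(i, 1), by have := j.2; simp only; omega, Or.inl rfl⟩, ?_⟩
      have : (⟨i.val + 1, by have := j.2; omega⟩ : Fin n) = j := Fin.ext hij
      simp [refl, up, this]
    · refine ⟨⟨(i, -1), by have := j.2; simp only; omega, Or.inr hi⟩, ?_⟩
      have : (⟨i.val + 1, by have := j.2; omega⟩ : Fin n) = j := Fin.ext hij
      simp [refl, up, this]
  · rintro ⟨p, rfl⟩
    refine ⟨p.1.1, (up p).1, rfl, ?_⟩
    unfold refl
    split_ifs with h
    · exact Or.inl rfl
    · exact Or.inr ⟨p.2.2.resolve_left h, rfl⟩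

theorem refl_mem (p : SimpleIdx n) : refl p ∈ weylD n :=
  Subgroup.subset_closure (mem_simpleD_iff.2 ⟨p, rfl⟩)

theorem isSigned_refl (p : SimpleIdx n) : IsSigned (refl p) := (isSigned_of_mem_weylD (refl_mem p)).1

theorem refl_mul_refl (p : SimpleIdx n) : refl p * refl p = 1 := by
  have hs : s p.1.1 (up p).1 * s p.1.1 (up p).1 = 1 := by
    ext1 x; simp [s_apply, Equiv.Perm.mul_apply]
  unfold refl
  split_ifs with h
  · exact hs
  · calc t n * s p.1.1 (up p).1 * t n * (t n * s p.1.1 (up p).1 * t n)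
        = t n * s p.1.1 (up p).1 * (t n * t n) * s p.1.1 (up p).1 * t n := by group
      _ = t n * (s p.1.1 (up p).1 * s p.1.1 (up p).1) * t n := by rw [t_mul_t]; group
      _ = 1 := by rw [hs, mul_one, t_mul_t]

theorem refl_apply_refl (p : SimpleIdx n) (x : SignedIdx n) : refl p (refl p x) = x := by
  rw [← Equiv.Perm.mul_apply, refl_mul_refl]; rfl

theorem refl_apply_self (p : SimpleIdx n) : refl p p.1 = up p := by
  obtain ⟨⟨i, e⟩, h1, h2⟩ := p
  rcases Int.units_eq_one_or e with rfl | rfl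
  · simp [refl, s_apply, up]
  · have h0 : i.val = 0 := by simpa using h2
    simp [refl, s_apply, up, Equiv.Perm.mul_apply, t_apply, h0]

theorem refl_apply_up (p : SimpleIdx n) : refl p (up p) = p.1 := by
  rw [← refl_apply_self, refl_apply_refl]

theorem refl_apply_neg_self (p : SimpleIdx n) : refl p (neg p.1) = neg (up p) := by
  rw [isSigned_refl, refl_apply_self]

theorem refl_apply_neg_up (p : SimpleIdx n) : refl p (neg (up p)) = neg p.1 := by
  rw [isSigned_refl, refl_apply_up]

theorem refl_apply_of_ne (p : SimpleIdx n) {x : SignedIdx n} (h1 : x.1 ≠ p.1.1)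
    (h2 : x.1 ≠ (up p).1) : refl p x = x := by
  unfold refl
  split_ifs with h
  · simp [s_apply, Equiv.swap_apply_of_ne_of_ne h1 h2]
  · have h0 : p.1.1.val = 0 := p.2.2.resolve_left h
    have h3 : x.1.val ≠ 0 := fun h3 => h1 (Fin.ext (h3.trans h0.symm))
    simp [s_apply, Equiv.Perm.mul_apply, t_apply, h3, Equiv.swap_apply_of_ne_of_ne h1 h2]

/-- The pairing of a signed index with the coroot of the simple root `p`. -/
def corootPairing (p : SimpleIdx n) (x : SignedIdx n) : ℤ :=
  if x = up p ∨ x = neg p.1 then 1 else if x = p.1 ∨ x = neg (up p) then -1 else 0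

theorem apply_refl (p : SimpleIdx n) {f : SignedIdx n → ℤ} (hf : IsOdd f) (x : SignedIdx n) :
    f (refl p x) = f x - corootPairing p x * (f (up p) - f p.1) := by
  have e1 : p.1 ≠ up p := fun h => fst_ne_up p (congrArg Prod.fst h)
  have e2 : p.1 ≠ neg (up p) := fun h =>
    fst_ne_up p (show _ = (neg (up p)).1 from congrArg Prod.fst h)
  have e3 : neg (up p) ≠ neg p.1 := fun h =>
    fst_ne_up p (show (neg p.1).1 = (neg (up p)).1 from (congrArg Prod.fst h).symm)
  unfold corootPairing
  by_cases h1 : x.1 = p.1.1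
  · rcases fst_eq_iff.1 h1 with rfl | rfl
    · simp [refl_apply_self, e1, (neg_ne_self p.1).symm]
    · rw [refl_apply_neg_self, hf, hf]; simp; ring
  · by_cases h2 : x.1 = (up p).1
    · rcases fst_eq_iff.1 h2 with rfl | rfl
      · rw [refl_apply_up]; simp
      · rw [refl_apply_neg_up, hf, hf]; simp [neg_ne_self, e3]; ring
    · rw [refl_apply_of_ne p h1 h2]
      have a1 : x ≠ up p := by rintro rfl; exact h2 rfl
      have a2 : x ≠ neg p.1 := by rintro rfl; exact h1 rfl
      have a3 : x ≠ p.1 := by rintro rfl; exact h1 rfl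
      have a4 : x ≠ neg (up p) := by rintro rfl; exact h2 rfl
      simp [a1, a2, a3, a4]

/-- The simple reflection `p` permutes the positive roots other than the root `p`. -/
theorem rho_refl_lt (p : SimpleIdx n) {x y : SignedIdx n} (hxy : x.1 ≠ y.1) (h : rho x < rho y)
    (h1 : (x, y) ≠ (p.1, up p)) (h2 : (x, y) ≠ (neg (up p), neg p.1)) :
    rho (refl p x) < rho (refl p y) := by
  have hne : rho (refl p x) ≠ rho (refl p y) :=
    rho_ne fun h => hxy (((isSigned_refl p).fst_eq_iff x y).1 h)
  -- Since `rho` is one on a simple root, the reflection lowers `rho y - rho x` by the difference of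
  -- the pairings. A difference of two would force `(x, y)` to be an excluded pair or a pair of
  -- opposite indices; with at most one, the gap stays nonnegative, and it is never zero.
  have key : corootPairing p y - corootPairing p x ≤ 1 ∨
      rho x + 2 ≤ rho y ∧ corootPairing p y - corootPairing p x ≤ 2 := by
    by_contra hcon
    have hy : corootPairing p y = 1 ∨ corootPairing p y = -1 ∨ corootPairing p y = 0 := by
      unfold corootPairing; split_ifs <;> simp
    have hx : corootPairing p x = 1 ∨ corootPairing p x = -1 ∨ corootPairing p x = 0 := by
      unfold corootPairing; split_ifs <;> simp
    have hy' : corootPairing p y = 1 := by omega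
    have hx' : corootPairing p x = -1 := by omega
    have hy2 : y = up p ∨ y = neg p.1 := by
      by_contra hc; unfold corootPairing at hy'; rw [if_neg hc] at hy'; split_ifs at hy'; omega
    have hx2 : x = p.1 ∨ x = neg (up p) := by
      by_contra hc; unfold corootPairing at hx'; rw [if_neg hc] at hx'; split_ifs at hx'
    rcases hy2 with rfl | rfl <;> rcases hx2 with rfl | rfl
    · exact h1 rfl
    · exact hxy rfl
    · exact hxy rfl
    · exact h2 rfl
  have ax := apply_refl p isOdd_rho x
  have ay := apply_refl p isOdd_rho y
  have e : rho (up p) - rho p.1 = 1 := by rw [rho_up]; ring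
  rw [e, mul_one] at ax ay
  omega

/-- `w` maps the simple root `p` to a positive root. -/
def Asc (w : Equiv.Perm (SignedIdx n)) (p : SimpleIdx n) : Prop := rho (w p.1) < rho (w (up p))

instance (w : Equiv.Perm (SignedIdx n)) (p : SimpleIdx n) : Decidable (Asc w p) :=
  inferInstanceAs (Decidable (_ < _))

/-- The pairs of signed indices which represent the positive roots mapped by `w` to negative
roots. Every root is represented twice. -/
def inversions (w : Equiv.Perm (SignedIdx n)) : Finset (SignedIdx n × SignedIdx n) :=
  Finset.univ.filter fun q => q.1.1 ≠ q.2.1 ∧ rho q.1 < rho q.2 ∧ rho (w q.2) < rho (w q.1)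

theorem mem_inversions {w : Equiv.Perm (SignedIdx n)} {x y : SignedIdx n} :
    (x, y) ∈ inversions w ↔ x.1 ≠ y.1 ∧ rho x < rho y ∧ rho (w y) < rho (w x) := by
  simp [inversions]

theorem asc_mul_refl_of_not {w : Equiv.Perm (SignedIdx n)} (hw : IsSigned w) {p : SimpleIdx n}
    (h : ¬ Asc w p) : Asc (w * refl p) p := by
  have hne : rho (w p.1) ≠ rho (w (up p)) :=
    rho_ne fun h => fst_ne_up p ((hw.fst_eq_iff _ _).1 h)
  simp only [Asc, Equiv.Perm.mul_apply, refl_apply_self, refl_apply_up, not_lt] at *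
  omega

/-- By `rho_refl_lt`, the reflection carries the old inversions to new ones, and the only further
inversions come from its own root. They are two in number because a root is represented by two
pairs. -/
theorem card_inversions_mul_refl {w : Equiv.Perm (SignedIdx n)} (hw : IsSigned w) {p : SimpleIdx n}
    (h : Asc w p) : (inversions (w * refl p)).card = (inversions w).card + 2 := by
  have hA : p.1.1 ≠ (up p).1 := fst_ne_up p
  have hne : (p.1, up p) ≠ (neg (up p), neg p.1) := fun h =>
    hA (congrArg (fun q => q.1.1) h)
  have hnot : (p.1, up p) ∉ inversions w := fun hm => by
    have := (mem_inversions.1 hm).2.2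
    exact absurd h (not_lt.2 this.le)
  have hnot' : (neg (up p), neg p.1) ∉ inversions w := fun hm => by
    have := (mem_inversions.1 hm).2.2
    rw [hw, hw, isOdd_rho, isOdd_rho] at this
    exact absurd h (not_lt.2 (by linarith))
  have e : inversions (w * refl p) = insert (p.1, up p) (insert (neg (up p), neg p.1)
      ((inversions w).image fun q => (refl p q.1, refl p q.2))) := by
    ext ⟨x, y⟩
    simp only [Finset.mem_insert, Finset.mem_image]
    constructor
    · intro hm
      rw [or_iff_not_imp_left]
      intro h1
      rw [or_iff_not_imp_left]
      intro h2
      obtain ⟨a1, a2, a3⟩ := mem_inversions.1 hm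
      refine ⟨(refl p x, refl p y), mem_inversions.2 ⟨?_, rho_refl_lt p a1 a2 h1 h2, ?_⟩, ?_⟩
      · exact fun h => a1 (((isSigned_refl p).fst_eq_iff x y).1 h)
      · simpa only [Equiv.Perm.mul_apply] using a3
      · simp [refl_apply_refl]
    · rintro (h1 | h1 | ⟨⟨a, b⟩, hab, h1⟩)
      · simp only [Prod.mk.injEq] at h1
        obtain ⟨rfl, rfl⟩ := h1
        refine mem_inversions.2 ⟨hA, by rw [rho_up]; omega, ?_⟩
        simp only [Equiv.Perm.mul_apply, refl_apply_self, refl_apply_up]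
        exact h
      · simp only [Prod.mk.injEq] at h1
        obtain ⟨rfl, rfl⟩ := h1
        refine mem_inversions.2 ⟨fun h => hA h.symm, ?_, ?_⟩
        · rw [isOdd_rho, isOdd_rho, rho_up]; omega
        · simp only [Equiv.Perm.mul_apply, refl_apply_neg_self, refl_apply_neg_up, hw _, isOdd_rho _]
          exact neg_lt_neg h
      · simp only [Prod.mk.injEq] at h1
        obtain ⟨rfl, rfl⟩ := h1
        obtain ⟨a1, a2, a3⟩ := mem_inversions.1 hab
        refine mem_inversions.2 ⟨fun h => a1 (((isSigned_refl p).fst_eq_iff a b).1 h), ?_, ?_⟩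
        · refine rho_refl_lt p a1 a2 ?_ ?_
          · rintro h; rw [h] at hab; exact hnot hab
          · rintro h; rw [h] at hab; exact hnot' hab
        · simpa only [Equiv.Perm.mul_apply, refl_apply_refl] using a3
  have hinj : Function.Injective fun q : SignedIdx n × SignedIdx n => (refl p q.1, refl p q.2) := by
    rintro ⟨a, b⟩ ⟨c, d⟩ hq
    simpa using hq
  have m1 : (neg (up p), neg p.1) ∉
      (inversions w).image fun q => (refl p q.1, refl p q.2) := by
    rw [Finset.mem_image]
    rintro ⟨⟨a, b⟩, hab, hq⟩
    obtain ⟨h1, h2⟩ := Prod.ext_iff.1 hq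
    have ha : a = neg p.1 := by rw [← refl_apply_refl p a]; simp only at h1; rw [h1, refl_apply_neg_up]
    have hb : b = neg (up p) := by
      rw [← refl_apply_refl p b]; simp only at h2; rw [h2, refl_apply_neg_self]
    have := (mem_inversions.1 hab).2.1
    rw [ha, hb, isOdd_rho, isOdd_rho, rho_up] at this
    omega
  have m2 : (p.1, up p) ∉ insert (neg (up p), neg p.1)
      ((inversions w).image fun q => (refl p q.1, refl p q.2)) := by
    rw [Finset.mem_insert, not_or, Finset.mem_image]
    refine ⟨hne, ?_⟩
    rintro ⟨⟨a, b⟩, hab, hq⟩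
    obtain ⟨h1, h2⟩ := Prod.ext_iff.1 hq
    have ha : a = up p := by rw [← refl_apply_refl p a]; simp only at h1; rw [h1, refl_apply_self]
    have hb : b = p.1 := by
      rw [← refl_apply_refl p b]; simp only at h2; rw [h2, refl_apply_up]
    have := (mem_inversions.1 hab).2.1
    rw [ha, hb, rho_up] at this
    omega
  rw [e, Finset.card_insert_of_notMem m2, Finset.card_insert_of_notMem m1,
    Finset.card_image_of_injective _ hinj]

theorem card_inversions_mul_refl_of_not {w : Equiv.Perm (SignedIdx n)} (hw : IsSigned w)
    {p : SimpleIdx n} (h : ¬ Asc w p) :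
    (inversions (w * refl p)).card + 2 = (inversions w).card := by
  rw [← card_inversions_mul_refl (hw.mul (isSigned_refl p)) (asc_mul_refl_of_not hw h), mul_assoc,
    refl_mul_refl, mul_one]

end SignedPermutations

end DescentAlg

namespace DescentAlg

/-! ### Positive roots, the length function and a description of the group by parity. -/

section PositiveRoots

variable {n : ℕ}

/-- The root represented by the pair `(x, y)` is a sum of simple roots. -/
def PosComb (x y : SignedIdx n) : Prop :=
  ∃ L : List (SimpleIdx n), ∀ f : SignedIdx n → ℤ, IsOdd f →
    f y - f x = (L.map fun p => f (up p) - f p.1).sum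

theorem PosComb.refl (x : SignedIdx n) : PosComb x x := ⟨[], fun f _ => by simp⟩

theorem PosComb.trans {x y z : SignedIdx n} (h1 : PosComb x y) (h2 : PosComb y z) :
    PosComb x z := by
  obtain ⟨L1, h1⟩ := h1
  obtain ⟨L2, h2⟩ := h2
  exact ⟨L1 ++ L2, fun f hf => by rw [List.map_append, List.sum_append, ← h1 f hf, ← h2 f hf]; ring⟩

theorem PosComb.neg {x y : SignedIdx n} (h : PosComb x y) :
    PosComb (DescentAlg.neg y) (DescentAlg.neg x) := by
  obtain ⟨L, h⟩ := h
  exact ⟨L, fun f hf => by rw [← h f hf, hf, hf]; ring⟩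

theorem posComb_simple (p : SimpleIdx n) : PosComb p.1 (up p) := ⟨[p], fun f _ => by simp⟩

theorem posComb_of_le {i j : Fin n} (h : i ≤ j) : PosComb (i, 1) (j, 1) := by
  obtain ⟨j, hj⟩ := j
  induction j with
  | zero =>
    have : i = ⟨0, hj⟩ := le_antisymm h (Fin.le_def.2 (Nat.zero_le _))
    rw [this]; exact PosComb.refl _
  | succ j ih =>
    rcases eq_or_lt_of_le h with rfl | h'
    · exact PosComb.refl _
    · have hj' : j < n := by omega
      exact (ih hj' (Fin.le_def.2 (Nat.lt_succ_iff.1 (Fin.lt_def.1 h')))).trans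
        (posComb_simple ⟨(⟨j, hj'⟩, 1), hj, Or.inl rfl⟩)

theorem posComb_of_rho_lt {x y : SignedIdx n} (hxy : x.1 ≠ y.1) (h : rho x < rho y) :
    PosComb x y := by
  obtain ⟨i, e⟩ := x
  obtain ⟨j, e'⟩ := y
  have hij : i.val ≠ j.val := fun h => hxy (Fin.ext h)
  have hi := i.2
  have hj := j.2
  -- The chain of simple steps runs from `-i` up to `-0`, crosses to `1` by the extra simple root of
  -- type `D`, and climbs to `j`.
  have hneg : ∀ (i j : Fin n) (hj : j.val ≠ 0), PosComb (i, -1) (j, 1) := fun i j hj0 => by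
    have hj := j.2
    have h0 : (⟨0, by omega⟩ : Fin n) ≤ i := Fin.le_def.2 (Nat.zero_le _)
    have h1 : (⟨1, by omega⟩ : Fin n) ≤ j := Fin.le_def.2 (by simp only; omega)
    exact (posComb_of_le h0).neg.trans ((posComb_simple
      ⟨(⟨0, by omega⟩, -1), by simp only; omega, Or.inr rfl⟩).trans (posComb_of_le h1))
  rcases Int.units_eq_one_or e with rfl | rfl <;> rcases Int.units_eq_one_or e' with rfl | rfl <;>
    simp only [rho_pos, rho_neg] at h
  · exact posComb_of_le (Fin.le_def.2 (by omega))
  · omega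
  · by_cases hj0 : j.val = 0
    · exact (hneg j i (by omega)).neg
    · exact hneg i j hj0
  · exact (posComb_of_le (Fin.le_def.2 (by omega) : j ≤ i)).neg

/-- An odd function is dominant if it is nonnegative on the simple roots. -/
def Dominant (f : SignedIdx n → ℤ) : Prop := ∀ p : SimpleIdx n, f p.1 ≤ f (up p)

theorem Dominant.le {f : SignedIdx n → ℤ} (hd : Dominant f) (hf : IsOdd f) {x y : SignedIdx n}
    (hxy : x.1 ≠ y.1) (h : rho x < rho y) : f x ≤ f y := by
  obtain ⟨L, hL⟩ := posComb_of_rho_lt hxy h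
  have := hL f hf
  have h0 : 0 ≤ (L.map fun p => f (up p) - f p.1).sum := by
    apply List.sum_nonneg
    simp only [List.mem_map]
    rintro _ ⟨p, -, rfl⟩
    linarith [hd p]
  omega

/-- A signed permutation that maps all simple roots on which the dominant function `f` vanishes
to positive roots does so with all positive roots on which `f` vanishes. -/
theorem Dominant.rho_lt {f : SignedIdx n → ℤ} (hd : Dominant f) (hf : IsOdd f)
    {w : Equiv.Perm (SignedIdx n)} (hw : IsSigned w) (h : ∀ p, f p.1 = f (up p) → Asc w p)
    {x y : SignedIdx n} (hxy : x.1 ≠ y.1) (hlt : rho x < rho y) (he : f x = f y) :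
    rho (w x) < rho (w y) := by
  obtain ⟨L, hL⟩ := posComb_of_rho_lt hxy hlt
  have h1 := hL f hf
  have h2 := hL _ (isOdd_rho.comp hw)
  -- The nonnegative values of `f` on the simple summands add up to zero, so each of them is zero.
  have hz : ∀ p ∈ L, f p.1 = f (up p) := by
    have hs : (L.map fun p => f (up p) - f p.1).sum = 0 := by omega
    have hnn : ∀ p ∈ L, 0 ≤ f (up p) - f p.1 := fun p _ => by linarith [hd p]
    clear hL h1 h2
    induction L with
    | nil => simp
    | cons a L ih =>
      rw [List.map_cons, List.sum_cons] at hs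
      have ha := hnn a (by simp)
      have hL : 0 ≤ (L.map fun p => f (up p) - f p.1).sum := by
        apply List.sum_nonneg
        simp only [List.mem_map]
        rintro _ ⟨p, hp, rfl⟩
        exact hnn p (by simp [hp])
      intro p hp
      rcases List.mem_cons.1 hp with rfl | hp
      · omega
      · exact ih (by omega) (fun p hp => hnn p (by simp [hp])) p hp
  have h0 : 0 ≤ (L.map fun p => rho (w (up p)) - rho (w p.1)).sum := by
    apply List.sum_nonneg
    simp only [List.mem_map]
    rintro _ ⟨p, hp, rfl⟩
    have := h p (hz p hp)
    unfold Asc at this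
    omega
  have hne : rho (w x) ≠ rho (w y) := rho_ne fun h => hxy ((hw.fst_eq_iff _ _).1 h)
  omega

theorem rho_le (x : SignedIdx n) : rho x ≤ (n : ℤ) - 1 := by
  obtain ⟨i, e⟩ := x
  have := i.2
  rcases Int.units_eq_one_or e with rfl | rfl
  · simp
  · simp; omega

theorem eq_of_rho_eq {x : SignedIdx n} {i : Fin n} (hi : i.val ≠ 0) (h : rho x = i.val) :
    x = (i, 1) := by
  obtain ⟨j, e⟩ := x
  rcases Int.units_eq_one_or e with rfl | rfl <;> simp at h
  · exact Prod.ext (Fin.ext h) rfl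
  · omega

/-- The two simple roots at the index `0` force `rho (w (1, 1)) > |rho (w (0, 1))|`, so going
upwards `rho (w (k, 1)) ≥ k` for `k ≥ 1`; going downwards from the last index gives `≤ k`. Hence all
indices except `0` are fixed with their signs, and the parity determines the sign at `0`. -/
theorem eq_one_of_forall_asc {w : Equiv.Perm (SignedIdx n)} (hw : IsSigned w)
    (hp : parity w = 1) (h : ∀ p, Asc w p) : w = 1 := by
  have hlo : ∀ k (hk : k + 1 < n), (k : ℤ) + 1 ≤ rho (w (⟨k + 1, hk⟩, 1)) := by
    intro k
    induction k with
    | zero =>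
      intro hk
      have h1 := h ⟨(⟨0, by omega⟩, 1), hk, Or.inl rfl⟩
      have h2 := h ⟨(⟨0, by omega⟩, -1), hk, Or.inr rfl⟩
      have h3 := (isOdd_rho.comp hw) (⟨0, by omega⟩, 1)
      unfold Asc at h1 h2
      simp only [neg, up] at h1 h2 h3
      simp only [zero_add] at *
      push_cast
      omega
    | succ k ih =>
      intro hk
      have h1 := h ⟨(⟨k + 1, by omega⟩, 1), hk, Or.inl rfl⟩
      have := ih (by omega)
      unfold Asc up at h1
      simp only at h1
      push_cast at *
      omega
  have hhi : ∀ d k (hk : k < n), k + d + 1 = n → rho (w (⟨k, hk⟩, 1)) ≤ k := by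
    intro d
    induction d with
    | zero => intro k hk hd; have := rho_le (w (⟨k, hk⟩, 1)); omega
    | succ d ih =>
      intro k hk hd
      have h1 := ih (k + 1) (by omega) (by omega)
      have h2 := h ⟨(⟨k, hk⟩, 1), by simp only; omega, Or.inl rfl⟩
      unfold Asc up at h2
      simp only at h2
      push_cast at *
      omega
  have hpos : ∀ i : Fin n, i.val ≠ 0 → w (i, 1) = (i, 1) := by
    rintro ⟨i, hi⟩ hi0
    simp only at hi0
    obtain ⟨k, rfl⟩ := Nat.exists_eq_succ_of_ne_zero hi0
    apply eq_of_rho_eq hi0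
    have h1 := hlo k hi
    have h2 := hhi (n - (k + 2)) (k + 1) hi (by omega)
    simp only [Nat.succ_eq_add_one] at *
    push_cast at *
    omega
  have hfst : ∀ i : Fin n, (w (i, 1)).1 = i := by
    intro i
    by_cases hi : i.val = 0
    · by_contra hne
      set k := (w (i, 1)).1 with hk
      have hk0 : k.val ≠ 0 := fun h => hne (Fin.ext (h.trans hi.symm))
      have := hpos k hk0
      have h2 : (w (i, 1)).1 = (w (k, 1)).1 := by rw [this]
      exact hne ((hw.fst_eq_iff _ _).1 h2).symm
    · rw [hpos i hi]
  have hsnd : ∀ i : Fin n, (w (i, 1)).2 = 1 := by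
    intro i
    by_cases hi : i.val = 0
    · have : parity w = (w (i, 1)).2 := Finset.prod_eq_single i
        (fun j _ hj => by rw [hpos j fun h => hj (Fin.ext (h.trans hi.symm))]) (by simp)
      rw [← this, hp]
    · rw [hpos i hi]
  ext1 x
  refine Prod.ext ?_ ?_
  · rw [hw.fst_apply, hfst]; rfl
  · rw [hw.snd_apply, hsnd, one_mul]; rfl

/-- Multiplying by the reflection of a descent removes two inversions and keeps the parity, so this
process ends at the identity. -/
theorem mem_weylD_iff {w : Equiv.Perm (SignedIdx n)} :
    w ∈ weylD n ↔ IsSigned w ∧ parity w = 1 := by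
  refine ⟨isSigned_of_mem_weylD, ?_⟩
  induction hk : (inversions w).card using Nat.strong_induction_on generalizing w with
  | _ k ih =>
    subst hk
    rintro ⟨hw, hp⟩
    by_cases h : ∀ p, Asc w p
    · rw [eq_one_of_forall_asc hw hp h]; exact one_mem _
    · push Not at h
      obtain ⟨p, h⟩ := h
      have hc := card_inversions_mul_refl_of_not hw h
      have hr := isSigned_of_mem_weylD (refl_mem p)
      have := ih _ (by omega) rfl ⟨hw.mul hr.1, by rw [parity_mul hw hr.1, hp, hr.2, mul_one]⟩
      have h2 := mul_mem this (refl_mem p)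
      rwa [mul_assoc, refl_mul_refl, mul_one] at h2

/-- The simple reflection `p` as an element of the Weyl group. -/
def reflW (p : SimpleIdx n) : weylD n := ⟨refl p, refl_mem p⟩

theorem mem_gensD_iff {w : weylD n} : w ∈ gensD n ↔ ∃ p, reflW p = w := by
  simp only [gensD, Set.mem_ofPred_eq, mem_simpleD_iff, reflW, Subtype.ext_iff]

theorem weylD_isSigned (w : weylD n) : IsSigned w.1 := (mem_weylD_iff.1 w.2).1

theorem exists_word (w : weylD n) : ∃ l : List (weylD n), (∀ s ∈ l, s ∈ gensD n) ∧ l.prod = w ∧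
    2 * l.length = (inversions w.1).card := by
  induction hk : (inversions w.1).card using Nat.strong_induction_on generalizing w with
  | _ k ih =>
    subst hk
    by_cases h : ∀ p, Asc w.1 p
    · have h1 := eq_one_of_forall_asc (weylD_isSigned w) (mem_weylD_iff.1 w.2).2 h
      refine ⟨[], by simp, by simpa [Subtype.ext_iff] using h1.symm, ?_⟩
      rw [h1]
      have : inversions (1 : Equiv.Perm (SignedIdx n)) = ∅ := by
        ext ⟨x, y⟩
        rw [mem_inversions]
        simp only [Equiv.Perm.one_apply, Finset.notMem_empty, iff_false]
        omega
      simp [this]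
    · push Not at h
      obtain ⟨p, h⟩ := h
      have hc : (inversions (w * reflW p).1).card + 2 = (inversions w.1).card :=
        card_inversions_mul_refl_of_not (weylD_isSigned w) h
      obtain ⟨l, h1, h2, h3⟩ := ih _ (by omega) (w * reflW p) rfl
      refine ⟨l ++ [reflW p], ?_, ?_, ?_⟩
      · intro x hx
        rcases List.mem_append.1 hx with hx | hx
        · exact h1 x hx
        · exact mem_gensD_iff.2 ⟨p, (List.mem_singleton.1 hx).symm⟩
      · rw [List.prod_append, h2, List.prod_singleton, mul_assoc]
        have : reflW p * reflW p = 1 := Subtype.ext (refl_mul_refl p)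
        rw [this, mul_one]
      · rw [List.length_append, List.length_singleton, mul_add, h3]
        exact hc

theorem card_inversions_le (l : List (weylD n)) (h : ∀ s ∈ l, s ∈ gensD n) :
    (inversions l.prod.1).card ≤ 2 * l.length := by
  induction l using List.reverseRecOn with
  | nil =>
    have : inversions (1 : Equiv.Perm (SignedIdx n)) = ∅ := by
      ext ⟨x, y⟩
      rw [mem_inversions]
      simp only [Equiv.Perm.one_apply, Finset.notMem_empty, iff_false]
      omega
    simp [this]
  | append_singleton l a ih =>
    have := ih fun s hs => h s (by simp [hs])
    obtain ⟨p, rfl⟩ := mem_gensD_iff.1 (h a (by simp))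
    have hw := weylD_isSigned l.prod
    have hstep : (inversions (l.prod.1 * refl p)).card ≤ (inversions l.prod.1).card + 2 := by
      by_cases hasc : Asc l.prod.1 p
      · exact (card_inversions_mul_refl hw hasc).le
      · have := card_inversions_mul_refl_of_not hw hasc; omega
    rw [List.prod_append, List.prod_singleton, List.length_append, List.length_singleton]
    simp only [reflW, Subgroup.coe_mul]
    omega

/-- A generator changes the number of inversions by exactly two, which bounds every word from below;
removing descents produces a word that attains the bound. -/
theorem two_mul_length (w : weylD n) : 2 * length (gensD n) w = (inversions w.1).card := by
  obtain ⟨l, h1, h2, h3⟩ := exists_word w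
  have hne : {k : ℕ | ∃ l : List (weylD n), (∀ s ∈ l, s ∈ gensD n) ∧ l.prod = w ∧
      l.length = k}.Nonempty := ⟨_, l, h1, h2, rfl⟩
  obtain ⟨l', h1', h2', h3'⟩ := Nat.sInf_mem hne
  have hle : length (gensD n) w ≤ l.length := Nat.sInf_le ⟨l, h1, h2, rfl⟩
  have hge := card_inversions_le l' h1'
  have h4 : l'.length = length (gensD n) w := h3'
  rw [h2'] at hge
  omega

theorem length_lt_mul_reflW_iff (w : weylD n) (p : SimpleIdx n) :
    length (gensD n) w < length (gensD n) (w * reflW p) ↔ Asc w.1 p := by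
  have h1 := two_mul_length w
  have h2 := two_mul_length (w * reflW p)
  have h3 : (w * reflW p).1 = w.1 * refl p := rfl
  rw [h3] at h2
  by_cases h : Asc w.1 p
  · have := card_inversions_mul_refl (weylD_isSigned w) h
    simp only [h, iff_true]; omega
  · have := card_inversions_mul_refl_of_not (weylD_isSigned w) h
    simp only [h, iff_false]; omega

end PositiveRoots

end DescentAlg

namespace DescentAlg

/-! ### Orbits of dominant vectors and Solomon's theorem. -/

section Solomon

variable {n : ℕ}

/-- The sum of the elements of the Weyl group which map the simple roots in `J` to positive
roots. -/
noncomputable def ascSum (J : Finset (SimpleIdx n)) : MonoidAlgebra ℚ (weylD n) :=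
  ∑ w : weylD n with ∀ p ∈ J, Asc w.1 p, MonoidAlgebra.of ℚ (weylD n) w

theorem ascSum_apply (J : Finset (SimpleIdx n)) (w : weylD n) :
    (ascSum J).coeff w = if ∀ p ∈ J, Asc w.1 p then 1 else 0 := by
  simp only [ascSum, MonoidAlgebra.coeff_sum, Finset.sum_apply', MonoidAlgebra.of_apply,
    MonoidAlgebra.coeff_single, Finsupp.single_apply, Finset.sum_ite_eq', Finset.mem_filter,
    Finset.mem_univ, true_and]

/-- This replaces the length function by the sign of roots; lengths play no role afterwards. -/
theorem setOf_xElt : {a | ∃ I ⊆ gensD n, a = xElt (gensD n) I} = Set.range (ascSum (n := n)) := by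
  classical
  have key : ∀ (I : Set (weylD n)) (J : Finset (SimpleIdx n)),
      (∀ s, s ∈ I ↔ ∃ p ∈ J, reflW p = s) → ascSum J = xElt (gensD n) I := by
    intro I J h
    unfold ascSum xElt
    refine Finset.sum_congr (Finset.filter_congr fun w _ => ?_) fun _ _ => rfl
    constructor
    · intro hw s hs
      obtain ⟨p, hp, rfl⟩ := (h s).1 hs
      exact (length_lt_mul_reflW_iff w p).2 (hw p hp)
    · intro hw p hp
      exact (length_lt_mul_reflW_iff w p).1 (hw _ ((h _).2 ⟨p, hp, rfl⟩))
  ext a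
  constructor
  · rintro ⟨I, hI, rfl⟩
    refine ⟨Finset.univ.filter fun p => reflW p ∈ I, key _ _ fun s => ⟨fun hs => ?_, ?_⟩⟩
    · obtain ⟨p, rfl⟩ := mem_gensD_iff.1 (hI hs)
      exact ⟨p, by simpa using hs, rfl⟩
    · rintro ⟨p, hp, rfl⟩
      simpa using hp
  · rintro ⟨J, rfl⟩
    refine ⟨reflW '' J, ?_, key _ _ fun s => by simp⟩
    rintro _ ⟨p, -, rfl⟩
    exact mem_gensD_iff.2 ⟨p, rfl⟩

theorem Dominant.rho_lt_of_lt {f : SignedIdx n → ℤ} (hd : Dominant f) (hf : IsOdd f)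
    {x y : SignedIdx n} (hxy : x.1 ≠ y.1) (h : f x < f y) : rho x < rho y := by
  by_contra hc
  have := rho_ne hxy
  exact absurd (hd.le hf hxy.symm (by omega)) (by omega)

/-- The simple roots on which `f` vanishes. -/
def zeroSet (f : SignedIdx n → ℤ) : Finset (SimpleIdx n) :=
  Finset.univ.filter fun p => f p.1 = f (up p)

theorem mem_zeroSet {f : SignedIdx n → ℤ} {p : SimpleIdx n} :
    p ∈ zeroSet f ↔ f p.1 = f (up p) := by simp [zeroSet]

/-- The image of a function on the signed indices under a permutation. -/
def transport (w : weylD n) (f : SignedIdx n → ℤ) : SignedIdx n → ℤ := fun x => f (w.1⁻¹ x)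

theorem transport_mul (v w : weylD n) (f : SignedIdx n → ℤ) :
    transport (v * w) f = transport v (transport w f) := by
  funext x
  simp [transport, Equiv.Perm.mul_apply]

theorem transport_one (f : SignedIdx n → ℤ) : transport (1 : weylD n) f = f := rfl

theorem fst_ne_apply {w : Equiv.Perm (SignedIdx n)} (hw : IsSigned w) (p : SimpleIdx n) :
    (w p.1).1 ≠ (w (up p)).1 := fun h => fst_ne_up p ((hw.fst_eq_iff _ _).1 h)

/-- The quotient `u⁻¹ * v` fixes `f`. It keeps a simple root positive: if `f` is positive there
because `f` stays positive on the image, and if `f` vanishes there because `u` and `v` both preserve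
positivity on the roots where `f` vanishes. Hence it is the identity. -/
theorem Dominant.eq_of_transport_eq {f : SignedIdx n → ℤ} (hd : Dominant f) (hf : IsOdd f)
    {u v : weylD n} (hu : ∀ p ∈ zeroSet f, Asc u.1 p) (hv : ∀ p ∈ zeroSet f, Asc v.1 p)
    (h : transport u f = transport v f) : u = v := by
  have hw : ∀ y, f ((u⁻¹ * v).1 y) = f y := fun y => by
    have := congrFun h (v.1 y)
    simpa [transport, Equiv.Perm.mul_apply] using this
  have hs := weylD_isSigned (u⁻¹ * v)
  have huw : ∀ y, u.1 ((u⁻¹ * v).1 y) = v.1 y := fun y => by simp [Equiv.Perm.mul_apply]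
  have h1 : (u⁻¹ * v).1 = 1 := by
    refine eq_one_of_forall_asc hs (mem_weylD_iff.1 (u⁻¹ * v).2).2 fun p => ?_
    by_cases hp : f p.1 = f (up p)
    · by_contra hc
      have hne := rho_ne (fst_ne_apply hs p)
      unfold Asc at hc
      have h2 := hd.rho_lt hf (weylD_isSigned u) (fun q hq => hu q (mem_zeroSet.2 hq))
        (fst_ne_apply hs p).symm (by omega) (by rw [hw, hw, hp])
      rw [huw, huw] at h2
      have h3 := hv p (mem_zeroSet.2 hp)
      unfold Asc at h3
      omega
    · refine hd.rho_lt_of_lt hf (fst_ne_apply hs p) ?_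
      rw [hw, hw]
      exact lt_of_le_of_ne (hd p) hp
  have h2 : u⁻¹ * v = 1 := Subtype.ext h1
  exact (inv_mul_eq_one.1 h2)

/-- Descents in `zeroSet f` can be removed one by one, because the corresponding reflections fix
`f`. -/
theorem exists_transport_eq {f : SignedIdx n → ℤ} (hf : IsOdd f) (w : weylD n) :
    ∃ u : weylD n, (∀ p ∈ zeroSet f, Asc u.1 p) ∧ transport u f = transport w f := by
  induction hk : (inversions w.1).card using Nat.strong_induction_on generalizing w with
  | _ k ih =>
    subst hk
    by_cases h : ∀ p ∈ zeroSet f, Asc w.1 p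
    · exact ⟨w, h, rfl⟩
    · push Not at h
      obtain ⟨p, hp, h⟩ := h
      have hc : (inversions (w * reflW p).1).card + 2 = (inversions w.1).card :=
        card_inversions_mul_refl_of_not (weylD_isSigned w) h
      obtain ⟨u, h1, h2⟩ := ih _ (by omega) (w * reflW p) rfl
      refine ⟨u, h1, h2.trans ?_⟩
      rw [transport_mul]
      congr 1
      funext x
      have : (refl p)⁻¹ = refl p := inv_eq_of_mul_eq_one_left (refl_mul_refl p)
      simp only [transport, reflW, this]
      rw [apply_refl p hf, mem_zeroSet.1 hp]
      ring

/-- The orbit of `f` under the Weyl group. -/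
noncomputable def orbit (f : SignedIdx n → ℤ) : Finset (SignedIdx n → ℤ) :=
  by classical exact Finset.univ.image fun w : weylD n => transport w f

theorem mem_orbit {f g : SignedIdx n → ℤ} : g ∈ orbit f ↔ ∃ w : weylD n, transport w f = g := by
  simp [orbit]

theorem sum_transport {M : Type*} [AddCommMonoid M] {f : SignedIdx n → ℤ} (hd : Dominant f)
    (hf : IsOdd f) (H : (SignedIdx n → ℤ) → M) :
    ∑ u : weylD n with ∀ p ∈ zeroSet f, Asc u.1 p, H (transport u f) = ∑ g ∈ orbit f, H g := by
  refine Finset.sum_bij (fun u _ => transport u f) (fun u _ => mem_orbit.2 ⟨u, rfl⟩) ?_ ?_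
    fun _ _ => rfl
  · intro u hu v hv h
    simp only [Finset.mem_filter, Finset.mem_univ, true_and] at hu hv
    exact hd.eq_of_transport_eq hf hu hv h
  · intro g hg
    obtain ⟨w, rfl⟩ := mem_orbit.1 hg
    obtain ⟨u, h1, h2⟩ := exists_transport_eq hf w
    exact ⟨u, by simpa using h1, h2⟩

theorem sum_orbit_transport {M : Type*} [AddCommMonoid M] (f : SignedIdx n → ℤ) (w : weylD n)
    (H : (SignedIdx n → ℤ) → M) :
    ∑ g ∈ orbit f, H (transport w g) = ∑ g ∈ orbit f, H g := by
  refine Finset.sum_bij (fun g _ => transport w g) ?_ ?_ ?_ fun _ _ => rfl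
  · intro g hg
    obtain ⟨v, rfl⟩ := mem_orbit.1 hg
    exact mem_orbit.2 ⟨w * v, transport_mul _ _ _⟩
  · intro g _ g' _ h
    have := congrArg (transport w⁻¹) h
    simpa only [← transport_mul, inv_mul_cancel, transport_one] using this
  · intro g hg
    obtain ⟨v, rfl⟩ := mem_orbit.1 hg
    exact ⟨transport (w⁻¹ * v) f, mem_orbit.2 ⟨_, rfl⟩, by rw [← transport_mul, mul_inv_cancel_left]⟩

/-- A root is positive exactly if `f` is positive on it, or `f` vanishes on it and `u` maps it to a
positive root. This lexicographic test is applied to the image of the simple root `p` under `u⁻¹ *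
w`. -/
theorem asc_inv_mul_iff {f : SignedIdx n → ℤ} (hd : Dominant f) (hf : IsOdd f) {u : weylD n}
    (hu : ∀ p ∈ zeroSet f, Asc u.1 p) (w : weylD n) (p : SimpleIdx n) :
    Asc (u⁻¹ * w).1 p ↔
      (transport w⁻¹ (transport u f) p.1 ≤ transport w⁻¹ (transport u f) (up p) ∧
        (transport w⁻¹ (transport u f) p.1 = transport w⁻¹ (transport u f) (up p) →
          Asc w.1 p)) := by
  have hs := weylD_isSigned (u⁻¹ * w)
  have hg : ∀ x, transport w⁻¹ (transport u f) x = f ((u⁻¹ * w).1 x) := fun x => by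
    simp [transport, Equiv.Perm.mul_apply]
  have hw : ∀ y, u.1 ((u⁻¹ * w).1 y) = w.1 y := fun y => by simp [Equiv.Perm.mul_apply]
  have hne := fst_ne_apply hs p
  have hlt : ∀ {x y : SignedIdx n}, x.1 ≠ y.1 → rho x < rho y → f x = f y →
      rho (u.1 x) < rho (u.1 y) := fun h1 h2 h3 =>
    hd.rho_lt hf (weylD_isSigned u) (fun q hq => hu q (mem_zeroSet.2 hq)) h1 h2 h3
  rw [hg, hg]
  constructor
  · intro h
    refine ⟨hd.le hf hne h, fun he => ?_⟩
    have := hlt hne h he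
    rwa [hw, hw] at this
  · rintro ⟨h1, h2⟩
    rcases h1.lt_or_eq with h1 | h1
    · exact hd.rho_lt_of_lt hf hne h1
    · by_contra hc
      have h3 := rho_ne hne
      have h4 := h2 h1
      unfold Asc at hc h4
      have h5 := hlt hne.symm (by omega) h1.symm
      rw [hw, hw] at h5
      omega

/-- The coefficient of `w` on the left counts the `u` in the first sum for which `u⁻¹ * w` occurs in
the second. By `asc_inv_mul_iff` this condition depends on `u` only through the orbit point `g = w⁻¹
u f`, and the part of it that involves `w` is membership in a smaller ascent set. -/
theorem ascSum_mul_ascSum {f : SignedIdx n → ℤ} (hd : Dominant f) (hf : IsOdd f)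
    (I : Finset (SimpleIdx n)) :
    ascSum (zeroSet f) * ascSum I =
      ∑ g ∈ orbit f, if ∀ p ∈ I, g p.1 ≤ g (up p) then
        ascSum (I.filter fun p => g p.1 = g (up p)) else 0 := by
  ext w
  have hL : (ascSum (zeroSet f) * ascSum I).coeff w =
      ∑ u : weylD n with ∀ p ∈ zeroSet f, Asc u.1 p,
        if ∀ p ∈ I, Asc (u⁻¹ * w).1 p then (1 : ℚ) else 0 := by
    have h0 : ascSum (zeroSet f) = ∑ u : weylD n with ∀ p ∈ zeroSet f, Asc u.1 p,
      MonoidAlgebra.of ℚ (weylD n) u := rfl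
    rw [h0, Finset.sum_mul]
    rw [MonoidAlgebra.coeff_sum, Finset.sum_apply']
    refine Finset.sum_congr rfl fun u _ => ?_
    rw [MonoidAlgebra.of_apply, MonoidAlgebra.coeff_single_mul_apply, ascSum_apply, one_mul]
  have hR : (∑ g ∈ orbit f, if ∀ p ∈ I, g p.1 ≤ g (up p) then
        ascSum (I.filter fun p => g p.1 = g (up p)) else 0).coeff w =
      ∑ g ∈ orbit f, if ∀ p ∈ I, g p.1 ≤ g (up p) ∧ (g p.1 = g (up p) → Asc w.1 p) then
        (1 : ℚ) else 0 := by
    rw [MonoidAlgebra.coeff_sum, Finset.sum_apply']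
    refine Finset.sum_congr rfl fun g _ => ?_
    by_cases h : ∀ p ∈ I, g p.1 ≤ g (up p)
    · rw [if_pos h, ascSum_apply]
      refine if_congr ?_ rfl rfl
      simp only [Finset.mem_filter, and_imp]
      exact ⟨fun h' p hp => ⟨h p hp, h' p hp⟩, fun h' p hp => (h' p hp).2⟩
    · rw [if_neg h, if_neg fun h' => h fun p hp => (h' p hp).1]
      rfl
  -- For fixed `w` the orbit is shifted by `w⁻¹`, so that the summation variable becomes `w⁻¹ u f`.
  rw [hL, hR, ← sum_orbit_transport f w⁻¹, ← sum_transport hd hf]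
  refine Finset.sum_congr rfl fun u hu => ?_
  simp only [Finset.mem_filter, Finset.mem_univ, true_and] at hu
  exact if_congr (forall₂_congr fun p _ => asc_inv_mul_iff hd hf hu w p) rfl rfl

theorem exists_dominant (J : Finset (SimpleIdx n)) :
    ∃ f : SignedIdx n → ℤ, Dominant f ∧ IsOdd f ∧ zeroSet f = J := by
  classical
  let c : ℕ → ℤˣ → ℤ := fun k e => if ∃ p ∈ J, p.1.1.val = k ∧ p.1.2 = e then 0 else 1
  have hc : ∀ p : SimpleIdx n, c p.1.1.val p.1.2 = if p ∈ J then 0 else 1 := by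
    intro p
    refine if_congr ⟨?_, fun h => ⟨p, h, rfl, rfl⟩⟩ rfl rfl
    rintro ⟨q, hq, h1, h2⟩
    have : q = p := Subtype.ext (Prod.ext (Fin.ext h1) h2)
    rwa [← this]
  -- The value at the index `0` is chosen so that both `f 1 - f 0` and `f 1 + f 0` are twice the
  -- prescribed indicators; the factor two avoids halves.
  let f : SignedIdx n → ℤ := fun x =>
    (x.2 : ℤ) * (c 0 (-1) - c 0 1 + 2 * ∑ k ∈ Finset.range x.1.val, c k 1)
  have hdiff : ∀ p : SimpleIdx n, f (up p) - f p.1 = if p ∈ J then 0 else 2 := by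
    rintro ⟨⟨i, e⟩, h1, h2⟩
    have h := hc ⟨⟨i, e⟩, h1, h2⟩
    have h2' : (if (⟨(i, e), h1, h2⟩ : SimpleIdx n) ∈ J then (0 : ℤ) else 2) = 2 * c i.val e := by
      simp only at h
      rw [h]; split_ifs <;> rfl
    rw [h2']
    rcases Int.units_eq_one_or e with rfl | rfl
    · simp [f, up, Finset.sum_range_succ]; ring
    · have h0 : i.val = 0 := by simpa using h2
      simp [f, up, h0]; ring
  refine ⟨f, fun p => ?_, fun x => by simp [f], ?_⟩
  · have := hdiff p
    split_ifs at this <;> omega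
  · ext p
    have := hdiff p
    rw [mem_zeroSet]
    split_ifs at this with h
    · simp only [h, iff_true]; omega
    · simp only [h, iff_false]; omega

/-- The span of the elements `ascSum K` for `K ⊆ I`. -/
noncomputable def spanLE (I : Finset (SimpleIdx n)) : Submodule ℚ (MonoidAlgebra ℚ (weylD n)) :=
  Submodule.span ℚ (ascSum '' {K | K ⊆ I})

/-- The span of the elements `ascSum K` for `K ⊂ I`. -/
noncomputable def spanLT (I : Finset (SimpleIdx n)) : Submodule ℚ (MonoidAlgebra ℚ (weylD n)) :=
  Submodule.span ℚ (ascSum '' {K | K ⊂ I})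

theorem ascSum_mul_mem (J I : Finset (SimpleIdx n)) : ascSum J * ascSum I ∈ spanLE I := by
  obtain ⟨f, hd, hf, rfl⟩ := exists_dominant J
  rw [ascSum_mul_ascSum hd hf]
  refine Submodule.sum_mem _ fun g _ => ?_
  split_ifs
  · exact Submodule.subset_span ⟨_, Finset.filter_subset _ _, rfl⟩
  · exact zero_mem _

theorem descentSpace_eq : descentSpace (gensD n) = Submodule.span ℚ (Set.range ascSum) := by
  rw [descentSpace, setOf_xElt]

theorem spanLE_le_descentSpace (I : Finset (SimpleIdx n)) : spanLE I ≤ descentSpace (gensD n) := by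
  rw [descentSpace_eq]
  exact Submodule.span_mono (Set.image_subset_range _ _)

theorem ascSum_mem_descentSpace (I : Finset (SimpleIdx n)) :
    ascSum I ∈ descentSpace (gensD n) := by
  rw [descentSpace_eq]
  exact Submodule.subset_span ⟨I, rfl⟩

theorem mul_ascSum_mem {a : MonoidAlgebra ℚ (weylD n)} (ha : a ∈ descentSpace (gensD n))
    (I : Finset (SimpleIdx n)) : a * ascSum I ∈ spanLE I := by
  rw [descentSpace_eq] at ha
  induction ha using Submodule.span_induction with
  | mem x hx => obtain ⟨J, rfl⟩ := hx; exact ascSum_mul_mem J I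
  | zero => simp
  | add x y _ _ hx hy => rw [add_mul]; exact add_mem hx hy
  | smul c x _ hx => rw [smul_mul_assoc]; exact Submodule.smul_mem _ _ hx

theorem mul_mem_descentSpace {a b : MonoidAlgebra ℚ (weylD n)} (ha : a ∈ descentSpace (gensD n))
    (hb : b ∈ descentSpace (gensD n)) : a * b ∈ descentSpace (gensD n) := by
  rw [descentSpace_eq] at hb
  induction hb using Submodule.span_induction with
  | mem x hx => obtain ⟨J, rfl⟩ := hx; exact spanLE_le_descentSpace J (mul_ascSum_mem ha J)
  | zero => simp
  | add x y _ _ hx hy => rw [mul_add]; exact add_mem hx hy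
  | smul c x _ hx => rw [mul_smul_comm]; exact Submodule.smul_mem _ _ hx

theorem ascSum_univ : ascSum (Finset.univ : Finset (SimpleIdx n)) = 1 := by
  ext w
  rw [ascSum_apply, MonoidAlgebra.one_def, MonoidAlgebra.coeff_single, Finsupp.single_apply]
  refine if_congr ⟨fun h => ?_, ?_⟩ rfl rfl
  · exact (Subtype.ext (eq_one_of_forall_asc (weylD_isSigned w) (mem_weylD_iff.1 w.2).2
      fun p => h p (Finset.mem_univ p))).symm
  · rintro rfl p -
    change rho p.1 < rho (up p)
    rw [rho_up]; omega

/-- Solomon's theorem. -/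
theorem toSubmodule_descentAlgebra :
    Subalgebra.toSubmodule (descentAlgebra (gensD n)) = descentSpace (gensD n) := by
  apply le_antisymm
  · intro a ha
    replace ha : a ∈ Algebra.adjoin ℚ {a | ∃ I ⊆ gensD n, a = xElt (gensD n) I} := ha
    rw [setOf_xElt] at ha
    induction ha using Algebra.adjoin_induction with
    | mem x hx => obtain ⟨J, rfl⟩ := hx; exact ascSum_mem_descentSpace J
    | algebraMap r =>
      rw [Algebra.algebraMap_eq_smul_one, ← ascSum_univ]
      exact Submodule.smul_mem _ _ (ascSum_mem_descentSpace _)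
    | add x y _ _ hx hy => exact add_mem hx hy
    | mul x y _ _ hx hy => exact mul_mem_descentSpace hx hy
  · exact Submodule.span_le.2 Algebra.subset_adjoin

theorem mem_descentAlgebra_iff {a : MonoidAlgebra ℚ (weylD n)} :
    a ∈ descentAlgebra (gensD n) ↔ a ∈ descentSpace (gensD n) := by
  rw [← toSubmodule_descentAlgebra]; rfl

end Solomon

end DescentAlg

namespace DescentAlg

/-! ### The triangular action and the radical. -/

section Radical

variable {n : ℕ}

/-- Left multiplication by `a` strictly lowers the filtration by the subspaces `spanLE`. -/
def LowersSpan (a : MonoidAlgebra ℚ (weylD n)) : Prop := ∀ I, a * ascSum I ∈ spanLT I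

theorem exists_smul_sub_mem {a : MonoidAlgebra ℚ (weylD n)} (ha : a ∈ descentSpace (gensD n))
    (I : Finset (SimpleIdx n)) : ∃ c : ℚ, a * ascSum I - c • ascSum I ∈ spanLT I := by
  have h := mul_ascSum_mem ha I
  have hle : spanLE I ≤ Submodule.span ℚ {ascSum I} ⊔ spanLT I := by
    refine Submodule.span_le.2 ?_
    rintro _ ⟨K, hK, rfl⟩
    rcases (show K ⊆ I from hK).eq_or_ssubset with rfl | hK
    · exact Submodule.mem_sup_left (Submodule.mem_span_singleton_self _)
    · exact Submodule.mem_sup_right (Submodule.subset_span ⟨K, hK, rfl⟩)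
  obtain ⟨y, hy, z, hz, hyz⟩ := Submodule.mem_sup.1 (hle h)
  obtain ⟨c, rfl⟩ := Submodule.mem_span_singleton.1 hy
  exact ⟨c, by rw [← hyz, add_sub_cancel_left]; exact hz⟩

theorem spanLE_le_spanLT {K I : Finset (SimpleIdx n)} (h : K ⊂ I) : spanLE K ≤ spanLT I :=
  Submodule.span_mono (Set.image_mono fun _ hL => lt_of_le_of_lt (α := Finset _) hL h)

theorem mul_mem_spanLT {a : MonoidAlgebra ℚ (weylD n)} (ha : a ∈ descentSpace (gensD n))
    {I : Finset (SimpleIdx n)} {v : MonoidAlgebra ℚ (weylD n)} (hv : v ∈ spanLT I) :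
    a * v ∈ spanLT I := by
  unfold spanLT at hv
  induction hv using Submodule.span_induction with
  | mem x hx => obtain ⟨K, hK, rfl⟩ := hx; exact spanLE_le_spanLT hK (mul_ascSum_mem ha K)
  | zero => simp
  | add x y _ _ hx hy => rw [mul_add]; exact add_mem hx hy
  | smul c x _ hx => rw [mul_smul_comm]; exact Submodule.smul_mem _ _ hx

theorem LowersSpan.mul_left {a b : MonoidAlgebra ℚ (weylD n)} (hb : LowersSpan b)
    (ha : a ∈ descentSpace (gensD n)) : LowersSpan (a * b) := fun I => by
  rw [mul_assoc]; exact mul_mem_spanLT ha (hb I)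

/-- The diagonal entries of the triangular action are scalars, so they cancel in a commutator. -/
theorem lowersSpan_commutator {a b : MonoidAlgebra ℚ (weylD n)}
    (ha : a ∈ descentSpace (gensD n)) (hb : b ∈ descentSpace (gensD n)) :
    LowersSpan (a * b - b * a) := fun I => by
  obtain ⟨c, hc⟩ := exists_smul_sub_mem ha I
  obtain ⟨d, hd⟩ := exists_smul_sub_mem hb I
  have h1 := mul_mem_spanLT ha hd
  have h2 := mul_mem_spanLT hb hc
  have h3 := Submodule.smul_mem _ d hc
  have h4 := Submodule.smul_mem _ c hd
  have e : (a * b - b * a) * ascSum I =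
      (a * (b * ascSum I - d • ascSum I) + d • (a * ascSum I - c • ascSum I)) -
      (b * (a * ascSum I - c • ascSum I) + c • (b * ascSum I - d • ascSum I)) := by
    simp only [mul_sub, sub_mul, mul_smul_comm, smul_sub, mul_assoc, smul_comm c d]
    abel
  rw [e]
  exact sub_mem (add_mem h1 h3) (add_mem h2 h4)

theorem lowersSpan_of_isNilpotent {a : MonoidAlgebra ℚ (weylD n)}
    (ha : a ∈ descentSpace (gensD n)) (hn : IsNilpotent a) : LowersSpan a := fun I => by
  obtain ⟨c, hc⟩ := exists_smul_sub_mem ha I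
  have hpow : ∀ k : ℕ, a ^ k * ascSum I - c ^ k • ascSum I ∈ spanLT I := by
    intro k
    induction k with
    | zero => simp
    | succ k ih =>
      have h1 := add_mem (mul_mem_spanLT ha ih) (Submodule.smul_mem _ (c ^ k) hc)
      have e : a * (a ^ k * ascSum I - c ^ k • ascSum I) +
          c ^ k • (a * ascSum I - c • ascSum I) =
          a ^ (k + 1) * ascSum I - c ^ (k + 1) • ascSum I := by
        simp only [mul_sub, mul_smul_comm, smul_sub, pow_succ' a, pow_succ c, mul_smul, mul_assoc]
        abel
      rwa [e] at h1
  obtain ⟨k, hk⟩ := hn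
  have h := hpow k
  rw [hk, zero_mul, zero_sub, neg_mem_iff] at h
  by_cases hc0 : c = 0
  · simpa [hc0] using hc
  -- In this case `ascSum I` itself would lie in the smaller span, which still gives the claim;
  -- linear independence of the `ascSum K` is therefore not needed.
  · have h2 : ascSum I ∈ spanLT I := (Submodule.smul_mem_iff _ (pow_ne_zero k hc0)).1 h
    have := add_mem hc (Submodule.smul_mem _ c h2)
    simpa using this

/-- The span of the elements `ascSum K` for `|K| < j`. -/
noncomputable def spanCard (n j : ℕ) : Submodule ℚ (MonoidAlgebra ℚ (weylD n)) :=
  Submodule.span ℚ (ascSum '' {K | K.card < j})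

theorem ascSum_mem_spanCard {K : Finset (SimpleIdx n)} {j : ℕ} (h : K.card < j) :
    ascSum K ∈ spanCard n j := Submodule.subset_span ⟨K, h, rfl⟩

theorem spanCard_zero : spanCard n 0 = ⊥ := by simp [spanCard]

theorem spanLT_le_spanCard (I : Finset (SimpleIdx n)) : spanLT I ≤ spanCard n I.card :=
  Submodule.span_mono (Set.image_mono fun _ hK => Finset.card_lt_card hK)

theorem spanCard_mono {i j : ℕ} (h : i ≤ j) : spanCard n i ≤ spanCard n j :=
  Submodule.span_mono (Set.image_mono fun _ hK => lt_of_lt_of_le hK h)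

theorem mul_mem_spanCard {a v : MonoidAlgebra ℚ (weylD n)} (ha : a ∈ descentSpace (gensD n))
    {j : ℕ} (hv : v ∈ spanCard n j) : a * v ∈ spanCard n j := by
  unfold spanCard at hv
  induction hv using Submodule.span_induction with
  | mem x hx =>
    obtain ⟨K, hK, rfl⟩ := hx
    have h : spanLE K ≤ spanCard n j :=
      Submodule.span_mono (Set.image_mono fun _ hL => lt_of_le_of_lt (Finset.card_le_card hL) hK)
    exact h (mul_ascSum_mem ha K)
  | zero => simp
  | add x y _ _ hx hy => rw [mul_add]; exact add_mem hx hy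
  | smul c x _ hx => rw [mul_smul_comm]; exact Submodule.smul_mem _ _ hx

theorem LowersSpan.mul_mem_spanCard {a v : MonoidAlgebra ℚ (weylD n)} (ha : LowersSpan a) {j : ℕ}
    (hv : v ∈ spanCard n (j + 1)) : a * v ∈ spanCard n j := by
  unfold spanCard at hv
  induction hv using Submodule.span_induction with
  | mem x hx =>
    obtain ⟨K, hK, rfl⟩ := hx
    exact spanCard_mono (Nat.lt_succ_iff.1 hK) (spanLT_le_spanCard K (ha K))
  | zero => simp
  | add x y _ _ hx hy => rw [mul_add]; exact add_mem hx hy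
  | smul c x _ hx => rw [mul_smul_comm]; exact Submodule.smul_mem _ _ hx

theorem card_simpleIdx_le : Fintype.card (SimpleIdx n) ≤ n := by
  conv_rhs => rw [← Fintype.card_fin n]
  refine Fintype.card_le_of_injective (fun p => if p.1.2 = 1 then (up p).1 else p.1.1) ?_
  rintro ⟨⟨i, e⟩, h1, h2⟩ ⟨⟨j, e'⟩, h3, h4⟩ h
  simp only [up] at h h2 h4
  rcases Int.units_eq_one_or e with rfl | rfl <;> rcases Int.units_eq_one_or e' with rfl | rfl <;>
    simp [Fin.ext_iff] at h h2 h4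
  · simp [Fin.ext_iff, h]
  · omega
  · omega
  · simp [Fin.ext_iff, h2, h4]

theorem one_mem_spanCard : (1 : MonoidAlgebra ℚ (weylD n)) ∈ spanCard n (n + 1) := by
  rw [← ascSum_univ]
  exact ascSum_mem_spanCard (Nat.lt_succ_iff.2 card_simpleIdx_le)

theorem LowersSpan.isNilpotent {a : MonoidAlgebra ℚ (weylD n)} (ha : LowersSpan a) :
    IsNilpotent a := by
  have h : ∀ k j, ∀ v ∈ spanCard n (k + j), a ^ k * v ∈ spanCard n j := by
    intro k
    induction k with
    | zero => intro j v hv; simpa using hv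
    | succ k ih =>
      intro j v hv
      rw [pow_succ', mul_assoc]
      exact ha.mul_mem_spanCard (ih (j + 1) v (by rwa [show k + (j + 1) = k + 1 + j by ring]))
  refine ⟨n + 1, ?_⟩
  have := h (n + 1) 0 1 one_mem_spanCard
  rwa [spanCard_zero, Submodule.mem_bot, mul_one] at this

variable {B : Subalgebra ℚ (MonoidAlgebra ℚ (weylD n))}

/-- The radical of the Artinian ring `B` is nilpotent, and a nilpotent triangular element has zero
diagonal. Conversely, if `b` has zero diagonal then so has every `y * b`, which is then nilpotent,
and `1 + y * b` is invertible in `B`. -/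
theorem mem_jacobson_iff (hB : B ≤ descentAlgebra (gensD n)) (b : B) :
    b ∈ Ring.jacobson B ↔ LowersSpan b.1 := by
  have hD : ∀ b : B, b.1 ∈ descentSpace (gensD n) := fun b => mem_descentAlgebra_iff.1 (hB b.2)
  rw [← Ideal.jacobson_bot]
  constructor
  · intro hb
    have : IsArtinianRing B := IsArtinianRing.of_finite ℚ B
    obtain ⟨k, hk⟩ := IsArtinianRing.isNilpotent_jacobson_bot (R := B)
    have h1 : b ^ k ∈ (⊥ : Ideal B).jacobson ^ k := Ideal.pow_mem_pow hb k
    rw [hk] at h1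
    refine lowersSpan_of_isNilpotent (hD b) ⟨k, ?_⟩
    have h2 : b ^ k = 0 := h1
    exact congrArg Subtype.val h2
  · intro hb
    refine Ideal.mem_jacobson_iff.2 fun y => ?_
    have h1 : LowersSpan (y.1 * b.1) := hb.mul_left (hD y)
    have h2 : IsNilpotent (y * b) := by
      obtain ⟨k, hk⟩ := h1.isNilpotent
      exact ⟨k, Subtype.ext hk⟩
    obtain ⟨u, hu⟩ := h2.isUnit_one_add
    refine ⟨(u⁻¹ : Bˣ), ?_⟩
    have h3 : ((u⁻¹ : Bˣ) : B) * (1 + y * b) = 1 := by rw [← hu, Units.inv_mul]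
    rw [mul_add, mul_one, ← mul_assoc] at h3
    rw [add_comm, h3, sub_self]
    exact zero_mem _

end Radical

/-! ### The longest element and the upper bound for the Loewy length. -/

section LongestElement

variable {n : ℕ}

/-- The permutation that negates all indices. -/
def negPerm (n : ℕ) : Equiv.Perm (SignedIdx n) := Function.Involutive.toPerm neg neg_neg_idx

theorem negPerm_apply (x : SignedIdx n) : negPerm n x = neg x := rfl

theorem isSigned_negPerm : IsSigned (negPerm n) := fun _ => rfl

theorem parity_negPerm : parity (negPerm n) = (-1) ^ n := by
  simp [parity, negPerm_apply]

/-- The longest element of the Weyl group, as a permutation. -/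
def longest (n : ℕ) : Equiv.Perm (SignedIdx n) := if Even n then negPerm n else negPerm n * t n

theorem longest_mem : longest n ∈ weylD n := by
  rw [mem_weylD_iff]
  unfold longest
  split_ifs with h
  · exact ⟨isSigned_negPerm, by rw [parity_negPerm, h.neg_one_pow]⟩
  · have h' := Nat.not_even_iff_odd.1 h
    refine ⟨isSigned_negPerm.mul isSigned_t, ?_⟩
    rw [parity_mul isSigned_negPerm isSigned_t, parity_negPerm, parity_t h'.pos, h'.neg_one_pow]
    rfl

/-- The longest element of the Weyl group. -/
def longestW (n : ℕ) : weylD n := ⟨longest n, longest_mem⟩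

theorem rho_t (x : SignedIdx n) : rho (t n x) = rho x := by
  rw [t_apply]
  split_ifs with h
  · simp [rho, h]
  · rfl

theorem rho_longest (x : SignedIdx n) : rho (longest n x) = -rho x := by
  unfold longest
  split_ifs
  · rw [negPerm_apply, isOdd_rho]
  · rw [Equiv.Perm.mul_apply, negPerm_apply, isOdd_rho, rho_t]

theorem longest_mul_self : longest n * longest n = 1 := by
  have hc : negPerm n * t n = t n * negPerm n := by
    ext1 x; simp [Equiv.Perm.mul_apply, negPerm_apply, isSigned_t x]
  have hn : negPerm n * negPerm n = 1 := by
    ext1 x; simp [Equiv.Perm.mul_apply, negPerm_apply]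
  unfold longest
  split_ifs
  · exact hn
  · rw [mul_assoc, hc, ← mul_assoc (t n), t_mul_t, one_mul, hn]

theorem longestW_mul_self : longestW n * longestW n = 1 := Subtype.ext longest_mul_self

theorem longestW_inv : (longestW n)⁻¹ = longestW n :=
  inv_eq_of_mul_eq_one_left longestW_mul_self

theorem negPerm_mul {w : Equiv.Perm (SignedIdx n)} (hw : IsSigned w) :
    negPerm n * w = w * negPerm n := by
  ext1 x; simp [Equiv.Perm.mul_apply, negPerm_apply, hw x]

theorem longestW_mul_of_even (hn : Even n) (w : weylD n) : longestW n * w = w * longestW n := by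
  apply Subtype.ext
  simp only [longestW, longest, if_pos hn, Subgroup.coe_mul]
  exact negPerm_mul (weylD_isSigned w)

/-- For odd `n` the longest element is `-t`, and `-1` commutes with every signed permutation. -/
theorem longestW_mul_of_odd (hn : ¬ Even n) (w : weylD n) :
    longestW n * w = sigmaD n w * longestW n := by
  apply Subtype.ext
  simp only [longestW, longest, if_neg hn, Subgroup.coe_mul, coe_sigmaD_apply, t_inv]
  calc negPerm n * t n * w.1 = negPerm n * (t n * w.1 * 1) := by rw [mul_one, mul_assoc]
    _ = (t n * w.1 * 1) * negPerm n :=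
        negPerm_mul ((isSigned_t.mul (weylD_isSigned w)).mul isSigned_one)
    _ = t n * w.1 * (t n * t n) * negPerm n := by rw [t_mul_t]
    _ = t n * w.1 * t n * (t n * negPerm n) := by group
    _ = t n * w.1 * t n * (negPerm n * t n) := by rw [negPerm_mul isSigned_t]

theorem asc_longestW_mul (w : weylD n) (p : SimpleIdx n) :
    Asc (longestW n * w).1 p ↔ ¬ Asc w.1 p := by
  have h := rho_ne (fst_ne_apply (weylD_isSigned w) p)
  simp only [Asc, longestW, Subgroup.coe_mul, Equiv.Perm.mul_apply, rho_longest]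
  omega

/-- The longest element in the group algebra. -/
noncomputable def longestA (n : ℕ) : MonoidAlgebra ℚ (weylD n) :=
  MonoidAlgebra.single (longestW n) 1

theorem longestA_mul_self : longestA n * longestA n = 1 := by
  rw [longestA, MonoidAlgebra.single_mul_single, longestW_mul_self, one_mul, MonoidAlgebra.one_def]

/-- Multiplication by the longest element exchanges ascents and descents; the indicator of having no
ascent in `I` is expanded by inclusion-exclusion. -/
theorem longestA_mul_ascSum (I : Finset (SimpleIdx n)) :
    longestA n * ascSum I = ∑ K ∈ I.powerset, (-1 : ℚ) ^ K.card • ascSum K := by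
  classical
  ext w
  rw [longestA, MonoidAlgebra.coeff_single_mul_apply, one_mul, longestW_inv, ascSum_apply,
    MonoidAlgebra.coeff_sum, Finset.sum_apply']
  simp only [MonoidAlgebra.coeff_smul_apply, ascSum_apply, asc_longestW_mul, smul_eq_mul]
  have h1 : (if ∀ p ∈ I, ¬ Asc w.1 p then (1 : ℚ) else 0) =
      ∏ p ∈ I, ((-1 : ℚ) * (if Asc w.1 p then 1 else 0) + 1) := by
    split_ifs with h
    · rw [Finset.prod_eq_one]
      intro p hp
      rw [if_neg (h p hp)]; norm_num
    · push Not at h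
      obtain ⟨p, hp, h⟩ := h
      rw [Finset.prod_eq_zero hp]
      rw [if_pos h]; norm_num
  rw [h1, Finset.prod_add]
  refine Finset.sum_congr rfl fun K _ => ?_
  rw [Finset.prod_const_one, mul_one, Finset.prod_mul_distrib, Finset.prod_const, Finset.prod_ite_zero,
    Finset.prod_const_one]
  congr

theorem longestA_mem : longestA n ∈ descentSpace (gensD n) := by
  rw [← mul_one (longestA n), ← ascSum_univ, longestA_mul_ascSum]
  exact Submodule.sum_mem _ fun K _ => Submodule.smul_mem _ _ (ascSum_mem_descentSpace K)

theorem longestA_mul_sub_mem {j : ℕ} {v : MonoidAlgebra ℚ (weylD n)}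
    (hv : v ∈ spanCard n (j + 1)) : longestA n * v - (-1 : ℚ) ^ j • v ∈ spanCard n j := by
  classical
  unfold spanCard at hv
  induction hv using Submodule.span_induction with
  | mem x hx =>
    obtain ⟨I, hI, rfl⟩ := hx
    have hI : I.card < j + 1 := hI
    rw [longestA_mul_ascSum]
    rcases (Nat.lt_succ_iff.1 hI).lt_or_eq with h | h
    · refine sub_mem (Submodule.sum_mem _ fun K hK => Submodule.smul_mem _ _
        (ascSum_mem_spanCard ?_)) (Submodule.smul_mem _ _ (ascSum_mem_spanCard h))
      exact lt_of_le_of_lt (Finset.card_le_card (Finset.mem_powerset.1 hK)) h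
    · subst h
      rw [← Finset.sum_erase_add _ _ (Finset.mem_powerset_self I), add_sub_cancel_right]
      refine Submodule.sum_mem _ fun K hK => Submodule.smul_mem _ _ (ascSum_mem_spanCard ?_)
      rw [Finset.mem_erase, Finset.mem_powerset] at hK
      exact Finset.card_lt_card (Finset.ssubset_iff_subset_ne.2 ⟨hK.2, hK.1⟩)
  | zero => simp
  | add x y _ _ hx hy =>
    have := add_mem hx hy
    rw [mul_add, smul_add]
    convert this using 1
    abel
  | smul c x _ hx =>
    have := Submodule.smul_mem _ c hx
    rwa [smul_sub, smul_comm, ← mul_smul_comm] at this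

/-- The part of `spanCard n j` on which the longest element acts with the sign opposite to its
sign on the top layer of `spanCard n (j + 1)`. -/
def SignedLayer (j : ℕ) (v : MonoidAlgebra ℚ (weylD n)) : Prop :=
  v ∈ spanCard n j ∧ longestA n * v = (-1 : ℚ) ^ (j + 1) • v

theorem mem_spanCard_of_sign {j : ℕ} {v : MonoidAlgebra ℚ (weylD n)}
    (hv : v ∈ spanCard n (j + 1)) (h : longestA n * v = (-1 : ℚ) ^ (j + 1) • v) :
    v ∈ spanCard n j := by
  have h1 := longestA_mul_sub_mem hv
  have e : longestA n * v - (-1 : ℚ) ^ j • v = ((-1 : ℚ) ^ (j + 1) * 2) • v := by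
    rw [h, ← sub_smul]; congr 1; ring
  rw [e] at h1
  exact (Submodule.smul_mem_iff _ (mul_ne_zero (pow_ne_zero _ (by norm_num)) two_ne_zero)).1 h1

/-- One layer is lost because `b` has zero diagonal, a second one because `b * v` has the same
eigenvalue as `v`, which is the wrong sign for the next layer. For `j ≤ 1` the product is zero, in
agreement with the truncated subtraction. -/
theorem SignedLayer.mul {j : ℕ} {b v : MonoidAlgebra ℚ (weylD n)} (hv : SignedLayer j v)
    (hb : LowersSpan b) (hc : longestA n * b = b * longestA n) : SignedLayer (j - 2) (b * v) := by
  obtain ⟨h1, h2⟩ := hv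
  match j with
  | 0 =>
    rw [spanCard_zero, Submodule.mem_bot] at h1
    simp [SignedLayer, h1]
  | 1 =>
    have := hb.mul_mem_spanCard h1
    rw [spanCard_zero, Submodule.mem_bot] at this
    simp [SignedLayer, this]
  | k + 2 =>
    have h3 : longestA n * (b * v) = (-1 : ℚ) ^ (k + 1) • (b * v) := by
      rw [← mul_assoc, hc, mul_assoc, h2, mul_smul_comm]
      congr 1
      ring
    exact ⟨mem_spanCard_of_sign (hb.mul_mem_spanCard h1) h3, h3⟩

/-- Nothing lies below `ascSum ∅`, so `a` annihilates it; but `ascSum ∅` is the sum over the whole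
group, whose square is `|W|` times itself. -/
theorem eq_zero_of_mem_spanCard_one {a : MonoidAlgebra ℚ (weylD n)} (ha : LowersSpan a)
    (h : a ∈ spanCard n 1) : a = 0 := by
  have h1 : spanCard n 1 ≤ Submodule.span ℚ {ascSum ∅} := by
    refine Submodule.span_le.2 ?_
    rintro _ ⟨K, hK, rfl⟩
    have hK : K.card < 1 := hK
    rw [Finset.card_eq_zero.1 (by omega : K.card = 0)]
    exact Submodule.mem_span_singleton_self _
  obtain ⟨c, rfl⟩ := Submodule.mem_span_singleton.1 (h1 h)
  have h2 := ha ∅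
  have h3 : spanLT (∅ : Finset (SimpleIdx n)) = ⊥ := by simp [spanLT]
  rw [h3, Submodule.mem_bot] at h2
  have h4 : ∀ u : weylD n, MonoidAlgebra.of ℚ (weylD n) u * ascSum ∅ = ascSum ∅ := fun u => by
    ext w
    rw [MonoidAlgebra.of_apply, MonoidAlgebra.coeff_single_mul_apply, ascSum_apply, ascSum_apply]
    simp
  have h5 : ascSum ∅ * ascSum ∅ = (Fintype.card (weylD n) : ℚ) • (ascSum ∅ : MonoidAlgebra ℚ (weylD n)) := by
    have e : (ascSum ∅ : MonoidAlgebra ℚ (weylD n)) =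
        ∑ w : weylD n, MonoidAlgebra.of ℚ (weylD n) w := by simp [ascSum]
    conv_lhs => rw [show (ascSum ∅ * ascSum ∅ : MonoidAlgebra ℚ (weylD n)) =
      (∑ w : weylD n, MonoidAlgebra.of ℚ (weylD n) w) * ascSum ∅ by rw [← e]]
    rw [Finset.sum_mul, Finset.sum_congr rfl fun u _ => h4 u, Finset.sum_const, Finset.card_univ,
      Nat.cast_smul_eq_nsmul]
  rw [smul_mul_assoc, h5, smul_smul] at h2
  have h6 := congrArg (fun a => MonoidAlgebra.coeff a 1) h2
  simp only [MonoidAlgebra.coeff_smul_apply, ascSum_apply] at h6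
  have hc : c = 0 := by simpa using h6
  rw [hc, zero_smul]

variable {B : Subalgebra ℚ (MonoidAlgebra ℚ (weylD n))}

theorem signedLayer_add : SignedLayer (n + 1) (1 + (-1 : ℚ) ^ n • longestA n) := by
  have hs : ((-1 : ℚ) ^ n) * (-1) ^ n = 1 := by rw [← mul_pow]; simp
  have hE : longestA n ∈ spanCard n (n + 1) := by
    rw [← mul_one (longestA n), ← ascSum_univ, longestA_mul_ascSum]
    exact Submodule.sum_mem _ fun K _ => Submodule.smul_mem _ _ (ascSum_mem_spanCard
      (Nat.lt_succ_iff.2 ((Finset.card_le_univ K).trans card_simpleIdx_le)))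
  refine ⟨add_mem one_mem_spanCard (Submodule.smul_mem _ _ hE), ?_⟩
  rw [mul_add, mul_one, mul_smul_comm, longestA_mul_self, smul_add, smul_smul, pow_add, pow_add,
    pow_one, mul_assoc, mul_assoc, mul_comm ((-1 : ℚ) * (-1)), ← mul_assoc]
  norm_num
  rw [hs, one_smul, add_comm]

theorem signedLayer_sub : SignedLayer n (1 - (-1 : ℚ) ^ n • longestA n) := by
  have hs : ((-1 : ℚ) ^ n) * (-1) ^ n = 1 := by rw [← mul_pow]; simp
  have hE : longestA n ∈ spanCard n (n + 1) := by
    rw [← mul_one (longestA n), ← ascSum_univ, longestA_mul_ascSum]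
    exact Submodule.sum_mem _ fun K _ => Submodule.smul_mem _ _ (ascSum_mem_spanCard
      (Nat.lt_succ_iff.2 ((Finset.card_le_univ K).trans card_simpleIdx_le)))
  have h : longestA n * (1 - (-1 : ℚ) ^ n • longestA n) =
      (-1 : ℚ) ^ (n + 1) • (1 - (-1 : ℚ) ^ n • longestA n) := by
    rw [mul_sub, mul_one, mul_smul_comm, longestA_mul_self, smul_sub, smul_smul, pow_succ,
      mul_assoc, mul_comm (-1 : ℚ), ← mul_assoc, hs]
    simp
    abel
  exact ⟨mem_spanCard_of_sign (sub_mem one_mem_spanCard (Submodule.smul_mem _ _ hE)) h, h⟩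

/-- Twice the identity is the sum of the eigenvectors in `signedLayer_add` and `signedLayer_sub`.
Each radical factor lowers both by two, and after `(n + 1) / 2` factors only the line of `ascSum ∅`
is left, which contains no nonzero radical element. -/
theorem jacobson_pow_eq_bot (hn : 1 ≤ n) (hB : B ≤ descentAlgebra (gensD n))
    (hc : ∀ b ∈ B, longestA n * b = b * longestA n) :
    Ring.jacobson B ^ ((n + 1) / 2) = ⊥ := by
  have hD : ∀ b : B, b.1 ∈ descentSpace (gensD n) := fun b => mem_descentAlgebra_iff.1 (hB b.2)
  have key : ∀ k (x : B), x ∈ Ring.jacobson B ^ k → ∀ j v, SignedLayer j v →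
      SignedLayer (j - 2 * k) (x.1 * v) := by
    intro k
    induction k with
    | zero =>
      intro x _ j v hv
      exact ⟨mul_mem_spanCard (hD x) hv.1, by
        rw [← mul_assoc, hc _ x.2, mul_assoc, hv.2, mul_smul_comm]
        rfl⟩
    | succ k ih =>
      intro x hx
      rw [Submodule.pow_succ] at hx
      induction hx using Submodule.mul_induction_on' with
      | mem_mul_mem y hy z hz =>
        intro j v hv
        have h1 := hv.mul ((mem_jacobson_iff hB z).1 hz) (hc _ z.2)
        have h2 := ih y hy _ _ h1
        rw [show j - 2 * (k + 1) = j - 2 - 2 * k by omega, Subalgebra.coe_mul, mul_assoc]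
        exact h2
      | add y _ z _ hy hz =>
        intro j v hv
        obtain ⟨a1, a2⟩ := hy j v hv
        obtain ⟨b1, b2⟩ := hz j v hv
        rw [Subalgebra.coe_add, add_mul]
        exact ⟨add_mem a1 b1, by rw [mul_add, a2, b2, smul_add]⟩
  rw [eq_bot_iff]
  intro x hx
  have h1 := (key _ x hx _ _ signedLayer_add).1
  have h2 := (key _ x hx _ _ signedLayer_sub).1
  have h3 := add_mem (spanCard_mono (j := 1) (by omega) h1) (spanCard_mono (j := 1) (by omega) h2)
  have h4 : x.1 * (1 + (-1 : ℚ) ^ n • longestA n) + x.1 * (1 - (-1 : ℚ) ^ n • longestA n) =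
      (2 : ℚ) • x.1 := by
    rw [two_smul, mul_add, mul_sub]; simp
  rw [h4] at h3
  have h5 : x.1 ∈ spanCard n 1 := (Submodule.smul_mem_iff _ two_ne_zero).1 h3
  have h6 : x ∈ Ring.jacobson B := by
    have : Ring.jacobson B ^ ((n + 1) / 2) ≤ Ring.jacobson B ^ 1 :=
      Ideal.pow_le_pow_right (by omega)
    rw [Submodule.pow_one] at this
    exact this hx
  exact Subtype.ext (eq_zero_of_mem_spanCard_one ((mem_jacobson_iff hB x).1 h6) h5)

theorem longestA_mul_of_even (hn : Even n) (a : MonoidAlgebra ℚ (weylD n)) :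
    longestA n * a = a * longestA n := by
  ext w
  rw [longestA, MonoidAlgebra.coeff_single_mul_apply, MonoidAlgebra.coeff_mul_single_apply,
    one_mul, mul_one, longestW_inv, longestW_mul_of_even hn]

theorem mem_fixedDescentAlgebra_iff {a : MonoidAlgebra ℚ (weylD n)} :
    a ∈ fixedDescentAlgebra (gensD n) (sigmaD n) ↔ a ∈ descentSpace (gensD n) ∧
      MonoidAlgebra.domCongr ℚ ℚ (sigmaD n) a = a := by
  rw [← mem_descentAlgebra_iff]; rfl

theorem longestA_mul_of_mem_fixed {a : MonoidAlgebra ℚ (weylD n)}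
    (ha : a ∈ fixedDescentAlgebra (gensD n) (sigmaD n)) : longestA n * a = a * longestA n := by
  by_cases hn : Even n
  · exact longestA_mul_of_even hn a
  · have h := (mem_fixedDescentAlgebra_iff.1 ha).2
    ext w
    rw [longestA, MonoidAlgebra.coeff_single_mul_apply, MonoidAlgebra.coeff_mul_single_apply,
      one_mul, mul_one, longestW_inv]
    conv_rhs => rw [← h, MonoidAlgebra.coeff_domCongr]
    congr 1
    apply (sigmaD n).injective
    rw [MulEquiv.apply_symm_apply, ← mul_right_cancel_iff (a := longestW n),
      ← longestW_mul_of_odd hn, ← mul_assoc, longestW_mul_self, mul_assoc, longestW_mul_self]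
    simp

end LongestElement

end DescentAlg

namespace DescentAlg

/-! ### A generating function for ranks under random signs. -/

section SignSums

variable {n : ℕ}

/-- The number of indices that precede `l` after the signs `g` have been attached. -/
def signRank (g : Fin n → ℤˣ) (l : Fin n) : ℕ :=
  (Finset.univ.filter fun k => k ≠ l ∧ rho (k, g k) < rho (l, g l)).card

/-- Once the sign at `l` is fixed, the other signs contribute independently. An index `k > l`
precedes `l` exactly if its sign is negative; an index `k < l` precedes `l` exactly if the sign at
`l` is positive. The sum thus becomes a product over the indices. -/
theorem sum_signRank {R : Type*} [CommRing R] (ψ χ : ℤˣ → R) (τ : R) (l : Fin n) :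
    ∑ g : Fin n → ℤˣ, ψ (g l) * (∏ k, if k = l then 1 else χ (g k)) * τ ^ signRank g l =
      (χ 1 + χ (-1) * τ) ^ (n - 1 - l.val) * (χ 1 + χ (-1)) ^ l.val *
        (ψ 1 * τ ^ l.val + ψ (-1)) := by
  let h : ℤˣ → Fin n → ℤˣ → R := fun e k d =>
    if k = l then (if d = e then ψ e else 0)
    else χ d * (if rho (k, d) < rho (l, e) then τ else 1)
  have hterm : ∀ g : Fin n → ℤˣ,
      ψ (g l) * (∏ k, if k = l then 1 else χ (g k)) * τ ^ signRank g l =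
        ∑ e : ℤˣ, ∏ k, h e k (g k) := by
    intro g
    rw [Finset.sum_eq_single (g l)]
    · have h1 : τ ^ signRank g l =
          ∏ k, if k ≠ l ∧ rho (k, g k) < rho (l, g l) then τ else 1 := by
        rw [Finset.prod_ite, Finset.prod_const_one, mul_one, Finset.prod_const, signRank]
      have h2 : ψ (g l) = ∏ k, if k = l then ψ (g l) else 1 := by simp
      rw [h1]
      conv_lhs => rw [h2]
      rw [← Finset.prod_mul_distrib, ← Finset.prod_mul_distrib]
      refine Finset.prod_congr rfl fun k _ => ?_
      by_cases hk : k = l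
      · subst hk; simp [h]
      · simp [h, hk]
    · intro e _ he
      refine Finset.prod_eq_zero (Finset.mem_univ l) ?_
      simp [h, he.symm]
    · exact fun h => absurd (Finset.mem_univ _) h
  have hprod : ∀ (e : ℤˣ) (c : R), (∀ k, k < l → ∑ d : ℤˣ, h e k d = c) →
      ∑ g : Fin n → ℤˣ, ∏ k, h e k (g k) =
        ψ e * c ^ l.val * (χ 1 + χ (-1) * τ) ^ (n - 1 - l.val) := by
    intro e c hc
    rw [← Fintype.piFinset_univ, ← Finset.prod_univ_sum]
    have hf : ∀ k, ∑ d : ℤˣ, h e k d = (if k = l then ψ e else 1) * (if k < l then c else 1) *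
        (if l < k then χ 1 + χ (-1) * τ else 1) := by
      intro k
      rcases lt_trichotomy k l with hk | rfl | hk
      · rw [hc k hk]; simp [hk.ne, hk, hk.not_gt]
      · simp only [h, if_true, Finset.sum_ite_eq', Finset.mem_univ, lt_irrefl, if_false, mul_one]
      · have hv : l.val < k.val := hk
        have e1 : ¬ (rho (k, (1 : ℤˣ)) < rho (l, e)) := by
          rcases Int.units_eq_one_or e with rfl | rfl
          · simp; omega
          · simp
        have e2 : rho (k, (-1 : ℤˣ)) < rho (l, e) := by
          rcases Int.units_eq_one_or e with rfl | rfl <;> simp <;> omega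
        have hu : (Finset.univ : Finset ℤˣ) = {1, -1} := rfl
        rw [hu, Finset.sum_pair (by decide)]
        simp only [h, if_neg hk.ne', if_neg hk.not_gt, if_pos hk, if_neg e1, if_pos e2]
        ring
    rw [Finset.prod_congr rfl fun k _ => hf k, Finset.prod_mul_distrib, Finset.prod_mul_distrib]
    congr 1
    · congr 1
      · simp
      · rw [Finset.prod_ite, Finset.prod_const_one, mul_one, Finset.prod_const]
        congr 1
        rw [Finset.filter_gt_eq_Iio, Fin.card_Iio]
    · rw [Finset.prod_ite, Finset.prod_const_one, mul_one, Finset.prod_const]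
      congr 1
      rw [Finset.filter_lt_eq_Ioi, Fin.card_Ioi]
  have hu : (Finset.univ : Finset ℤˣ) = {1, -1} := rfl
  rw [Finset.sum_congr rfl fun g _ => hterm g, Finset.sum_comm]
  have s1 := hprod 1 ((χ 1 + χ (-1)) * τ) (by
    intro k hk
    have hv : k.val < l.val := hk
    rw [hu, Finset.sum_pair (by decide)]
    have e1 : rho (k, (1 : ℤˣ)) < rho (l, 1) := by simp; omega
    have e2 : rho (k, (-1 : ℤˣ)) < rho (l, 1) := by simp; omega
    simp only [h, if_neg hk.ne, if_pos e1, if_pos e2]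
    ring)
  have s2 := hprod (-1) (χ 1 + χ (-1)) (by
    intro k hk
    have hv : k.val < l.val := hk
    rw [hu, Finset.sum_pair (by decide)]
    have e1 : ¬ rho (k, (1 : ℤˣ)) < rho (l, -1) := by simp
    have e2 : ¬ rho (k, (-1 : ℤˣ)) < rho (l, -1) := by simp; omega
    simp only [h, if_neg hk.ne, if_neg e1, if_neg e2]
    ring)
  rw [hu, Finset.sum_pair (by decide), s1, s2, mul_pow]
  ring

end SignSums

/-! ### The reflection representation and the elements of the vectors `(±1, 1, …, 1)`. -/

section Action

variable {n : ℕ}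

/-- The action of the group algebra on the functions on the signed indices. -/
noncomputable def act (n : ℕ) :
    MonoidAlgebra ℚ (weylD n) →ₐ[ℚ] Module.End ℚ (SignedIdx n → ℚ) :=
  MonoidAlgebra.lift ℚ (Module.End ℚ (SignedIdx n → ℚ)) (weylD n)
    { toFun := fun w => LinearMap.funLeft ℚ ℚ (w.1⁻¹ : Equiv.Perm (SignedIdx n))
      map_one' := by ext; rfl
      map_mul' := fun v w => by
        refine LinearMap.ext fun f => funext fun x => ?_
        simp [LinearMap.funLeft_apply] }

theorem act_ascSum (J : Finset (SimpleIdx n)) (f : SignedIdx n → ℚ) (x : SignedIdx n) :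
    act n (ascSum J) f x = ∑ w : weylD n with ∀ p ∈ J, Asc w.1 p, f (w.1⁻¹ x) := by
  rw [ascSum, map_sum, LinearMap.sum_apply, Finset.sum_apply]
  refine Finset.sum_congr rfl fun w _ => ?_
  simp [act, LinearMap.funLeft_apply]

theorem isOdd_act_ascSum (J : Finset (SimpleIdx n)) {f : SignedIdx n → ℚ} (hf : IsOdd f) :
    IsOdd (act n (ascSum J) f) := fun x => by
  rw [act_ascSum, act_ascSum, ← Finset.sum_neg_distrib]
  exact Finset.sum_congr rfl fun w _ => hf.comp (weylD_isSigned w).inv x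

/-- The odd function on the signed indices that extends a function on the absolute values. -/
def oddExt (n : ℕ) (F : ℕ → ℚ) : SignedIdx n → ℚ := fun x => ((x.2 : ℤ) : ℚ) * F x.1.val

theorem isOdd_oddExt (F : ℕ → ℚ) : IsOdd (oddExt n F) := fun x => by simp [oddExt]

theorem IsOdd.ext {f g : SignedIdx n → ℚ} (hf : IsOdd f) (hg : IsOdd g)
    (h : ∀ i, f (i, 1) = g (i, 1)) : f = g := by
  funext x
  obtain ⟨i, e⟩ := x
  rcases Int.units_eq_one_or e with rfl | rfl
  · exact h i
  · have h1 := hf (i, 1)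
    have h2 := hg (i, 1)
    simp only [neg] at h1 h2
    rw [h1, h2, h]

/-- The sign `η` at the index `0` and `1` elsewhere. -/
def headSign (η : ℤˣ) (i : Fin n) : ℤˣ := if i.val = 0 then η else 1

/-- The vector `(η, 1, …, 1)`. -/
def signVec (n : ℕ) (η : ℤˣ) (x : SignedIdx n) : ℤ := ((x.2 * headSign η x.1 : ℤˣ) : ℤ)

theorem isOdd_signVec (η : ℤˣ) : IsOdd (signVec n η) := fun x => by simp [signVec]

theorem dominant_signVec (η : ℤˣ) : Dominant (signVec n η) := fun p => by
  have : signVec n η (up p) = 1 := by simp [signVec, up, headSign]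
  rw [this]
  unfold signVec
  rcases Int.units_eq_one_or (p.1.2 * headSign η p.1.1) with h | h <;> simp [h]

theorem signVec_headSign (η : ℤˣ) (i : Fin n) : signVec n η (i, headSign η i) = 1 := by
  simp [signVec]

/-- The signs of the image of the vector `(η, 1, …, 1)` under `u`. -/
def signsOf (η : ℤˣ) (u : weylD n) (l : Fin n) : ℤˣ :=
  (u.1⁻¹ (l, 1)).2 * headSign η (u.1⁻¹ (l, 1)).1

theorem transport_signVec (η : ℤˣ) (u : weylD n) (x : SignedIdx n) :
    transport u (signVec n η) x = ((x.2 * signsOf η u x.1 : ℤˣ) : ℤ) := by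
  have hs := (weylD_isSigned u).inv
  unfold transport signVec signsOf
  rw [hs.fst_apply, hs.snd_apply, mul_comm _ x.2, mul_assoc]

theorem prod_signsOf (hn : 0 < n) (η : ℤˣ) (u : weylD n) : ∏ l, signsOf η u l = η := by
  have hs := (weylD_isSigned u).inv
  unfold signsOf
  rw [Finset.prod_mul_distrib]
  have h1 : ∏ l, (u.1⁻¹ (l, 1)).2 = 1 := (mem_weylD_iff.1 (u⁻¹).2).2
  have h2 : ∏ l : Fin n, headSign η (u.1⁻¹ (l, 1)).1 = ∏ l : Fin n, headSign η l :=
    Equiv.prod_comp hs.perm (headSign η)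
  have h3 : ∏ l : Fin n, headSign η l = η := by
    rw [Finset.prod_eq_single ⟨0, hn⟩]
    · rfl
    · intro i _ hi
      rw [headSign, if_neg fun h => hi (Fin.ext h)]
    · simp
  rw [h1, h2, h3, one_mul]

theorem exists_signsOf_eq (hn : 0 < n) {η : ℤˣ} {g : Fin n → ℤˣ} (hg : ∏ l, g l = η) :
    ∃ u : weylD n, (∀ p ∈ zeroSet (signVec n η), Asc u.1 p) ∧ signsOf η u = g := by
  -- A diagonal sign change taking `(η, 1, …, 1)` to `g`; its parity is one because `g` has product
  -- `η`.
  let D : Equiv.Perm (SignedIdx n) := Function.Involutive.toPerm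
    (fun x => (x.1, x.2 * (g x.1 * headSign η x.1))) fun x => by
      simp only
      rw [mul_assoc, Int.units_mul_self, mul_one]
  have hD : ∀ x, D x = (x.1, x.2 * (g x.1 * headSign η x.1)) := fun _ => rfl
  have hmem : D ∈ weylD n := by
    rw [mem_weylD_iff]
    refine ⟨fun x => by simp [hD, neg], ?_⟩
    simp only [parity, hD, one_mul, Finset.prod_mul_distrib, hg]
    rw [Finset.prod_eq_single ⟨0, hn⟩]
    · simp [headSign, Int.units_mul_self]
    · intro i _ hi
      rw [headSign, if_neg fun h => hi (Fin.ext h)]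
    · simp
  obtain ⟨u, h1, h2⟩ := exists_transport_eq (isOdd_signVec η) (⟨D, hmem⟩ : weylD n)⁻¹
  refine ⟨u, h1, ?_⟩
  funext l
  have h3 := congrFun h2 (l, 1)
  rw [transport_signVec] at h3
  have h4 : transport (⟨D, hmem⟩ : weylD n)⁻¹ (signVec n η) (l, 1) = ((g l : ℤˣ) : ℤ) := by
    simp [transport, hD, signVec, mul_assoc]
  rw [h4] at h3
  exact Units.ext (by simpa using h3)

theorem eq_of_signsOf_eq {η : ℤˣ} {u v : weylD n}
    (hu : ∀ p ∈ zeroSet (signVec n η), Asc u.1 p) (hv : ∀ p ∈ zeroSet (signVec n η), Asc v.1 p)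
    (h : signsOf η u = signsOf η v) : u = v := by
  refine (dominant_signVec η).eq_of_transport_eq (isOdd_signVec η) hu hv ?_
  funext x
  rw [transport_signVec, transport_signVec, h]

theorem apply_headSign (η : ℤˣ) (u : weylD n) (i : Fin n) :
    u.1 (i, headSign η i) = ((u.1 (i, 1)).1, signsOf η u (u.1 (i, 1)).1) := by
  have hs := weylD_isSigned u
  have h1 : (u.1 (i, headSign η i)).1 = (u.1 (i, 1)).1 := hs.fst_apply _
  refine Prod.ext h1 ?_
  simp only
  have h2 : u.1⁻¹ (u.1 (i, headSign η i)) = (i, headSign η i) := by simp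
  have h3 := hs.inv.snd_apply (u.1 (i, headSign η i))
  have h4 := hs.inv.fst_apply (u.1 (i, headSign η i))
  rw [h2, h1] at h3 h4
  simp only at h3 h4
  unfold signsOf
  rw [← h4]
  generalize (u.1⁻¹ ((u.1 (i, 1)).1, 1)).2 = a at *
  generalize (u.1 (i, headSign η i)).2 = b at *
  rw [h3, ← mul_assoc, Int.units_mul_self, one_mul]

/-- The vector is constant on the indices `(i, headSign η i)`, so `u` maps them in increasing order
of `i`. The preimage of `l` is therefore found by counting the images that precede it. -/
theorem signRank_signsOf {η : ℤˣ} {u : weylD n} (hu : ∀ p ∈ zeroSet (signVec n η), Asc u.1 p)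
    (l : Fin n) : signRank (signsOf η u) l = (u.1⁻¹ (l, 1)).1.val := by
  have hs := weylD_isSigned u
  set j := (u.1⁻¹ (l, 1)).1 with hj
  have hl : (u.1 (j, 1)).1 = l := by
    have := hs.fst_apply (u.1⁻¹ (l, 1))
    rw [← hj] at this
    rw [← this]; simp
  have hlt : ∀ i k : Fin n, i < k → rho (u.1 (i, headSign η i)) < rho (u.1 (k, headSign η k)) := by
    intro i k hik
    have hv : i.val < k.val := hik
    refine (dominant_signVec η).rho_lt (isOdd_signVec η) hs (fun q hq => hu q (mem_zeroSet.2 hq))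
      hik.ne ?_ (by rw [signVec_headSign, signVec_headSign])
    have hk : headSign η k = 1 := if_neg (by omega)
    rw [hk]
    rcases Int.units_eq_one_or (headSign η i) with h | h <;> rw [h] <;> simp <;> omega
  rw [signRank, ← Fin.card_Iio j]
  symm
  refine Finset.card_equiv hs.perm fun i => ?_
  rw [Finset.mem_Iio, Finset.mem_filter, hs.perm_apply]
  simp only [Finset.mem_univ, true_and]
  have e1 := apply_headSign η u i
  have e2 := apply_headSign η u j
  rw [hl] at e2
  rw [← e1, ← e2]
  constructor
  · intro h
    refine ⟨fun h' => h.ne ?_, hlt i j h⟩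
    exact (hs.fst_eq_iff (i, 1) (j, 1)).1 (h'.trans hl.symm)
  · rintro ⟨h1, h2⟩
    by_contra hc
    rcases (not_lt.1 hc).lt_or_eq with h | h
    · have := hlt j i h; omega
    · subst h; exact h1 hl

/-- The orbit of `(η, 1, …, 1)` consists of the sign vectors with product `η`. The extra factor `η`
at rank `0` undoes the sign at the head of the vector. -/
theorem act_signVec (hn : 0 < n) (η : ℤˣ) (F : ℕ → ℚ) (l : Fin n) :
    act n (ascSum (zeroSet (signVec n η))) (oddExt n F) (l, 1) =
      ∑ g : Fin n → ℤˣ with ∏ k, g k = η,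
        ((g l : ℤ) : ℚ) * (if signRank g l = 0 then ((η : ℤ) : ℚ) else 1) * F (signRank g l) := by
  rw [act_ascSum]
  refine Finset.sum_bij (fun u _ => signsOf η u) ?_ ?_ ?_ ?_
  · intro u _
    simp [prod_signsOf hn]
  · intro u hu v hv h
    simp only [Finset.mem_filter, Finset.mem_univ, true_and] at hu hv
    exact eq_of_signsOf_eq hu hv h
  · intro g hg
    simp only [Finset.mem_filter, Finset.mem_univ, true_and] at hg
    obtain ⟨u, h1, h2⟩ := exists_signsOf_eq hn hg
    exact ⟨u, by simpa using h1, h2⟩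
  · intro u hu
    simp only [Finset.mem_filter, Finset.mem_univ, true_and] at hu
    rw [signRank_signsOf hu]
    unfold oddExt signsOf headSign
    split_ifs with h
    · have : ((η : ℤ) : ℚ) * ((η : ℤ) : ℚ) = 1 := by
        rcases Int.units_eq_one_or η with rfl | rfl <;> simp
      push_cast
      rw [mul_assoc (((u.1⁻¹ (l, 1)).2 : ℤ) : ℚ), this, mul_one]
    · simp

end Action

end DescentAlg

namespace DescentAlg

/-! ### The element of the vector `(0, …, 0, 1)`. -/

section LastVector

variable {n : ℕ}

theorem perm_apply_inv {α : Type*} (w : Equiv.Perm α) (x : α) : w (w⁻¹ x) = x := by simp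

theorem perm_inv_apply {α : Type*} (w : Equiv.Perm α) (x : α) : w⁻¹ (w x) = x := by simp

/-- The vector `(0, …, 0, 1)`. -/
def lastVec (n : ℕ) (x : SignedIdx n) : ℤ := if x.1.val + 1 = n then (x.2 : ℤ) else 0

theorem isOdd_lastVec : IsOdd (lastVec n) := fun x => by
  unfold lastVec; simp only [neg_fst, neg_snd]; split_ifs with h <;> simp [h]

theorem dominant_lastVec : Dominant (lastVec n) := fun p => by
  have h := p.2.1
  have h1 : lastVec n p.1 = 0 := if_neg (by omega)
  rw [h1]
  unfold lastVec up
  split_ifs <;> simp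

theorem transport_lastVec (u : weylD n) (m : Fin n) (hm : m.val + 1 = n) (x : SignedIdx n) :
    transport u (lastVec n) x =
      if x = u.1 (m, 1) then 1 else if x = neg (u.1 (m, 1)) then -1 else 0 := by
  have hs := weylD_isSigned u
  obtain ⟨y, rfl⟩ := u.1.surjective x
  rw [← hs]
  simp only [u.1.injective.eq_iff, transport, perm_inv_apply, lastVec]
  obtain ⟨i, e⟩ := y
  have hi : i.val + 1 = n ↔ i = m := by rw [Fin.ext_iff]; omega
  simp only [neg, Prod.mk.injEq]
  by_cases h : i = m
  · rcases Int.units_eq_one_or e with rfl | rfl <;> simp [h, hm]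
  · simp [h, hi]

theorem exists_apply_last (hn : 2 ≤ n) (m : Fin n) (y : SignedIdx n) :
    ∃ w : weylD n, w.1 (m, 1) = y := by
  obtain ⟨i, e⟩ := y
  obtain ⟨k, hk⟩ : ∃ k : Fin n, k ≠ i := by
    have : Nontrivial (Fin n) := Fin.nontrivial_iff_two_le.2 hn
    exact exists_ne i
  -- The sign at `i` is repeated at a second index `k` to keep the parity equal to one.
  let c : Fin n → ℤˣ := fun j => if j = i then e else if j = k then e else 1
  let D : Equiv.Perm (SignedIdx n) := Function.Involutive.toPerm
    (fun x => (x.1, x.2 * c x.1)) fun x => by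
      simp only
      rw [mul_assoc, Int.units_mul_self, mul_one]
  have hD : ∀ x, D x = (x.1, x.2 * c x.1) := fun _ => rfl
  have hmem : D ∈ weylD n := by
    rw [mem_weylD_iff]
    refine ⟨fun x => by simp [hD, neg], ?_⟩
    have hc : ∀ j, c j = (if j = i then e else 1) * (if j = k then e else 1) := by
      intro j
      simp only [c]
      by_cases h1 : j = i
      · subst h1; simp [hk.symm]
      · simp [h1]
    simp only [parity, hD, one_mul, hc, Finset.prod_mul_distrib]
    simp [Int.units_mul_self]
  have hsw : s m i ∈ weylD n := mem_weylD_iff.2 ⟨isSigned_s m i, parity_s m i⟩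
  refine ⟨⟨D * s m i, mul_mem hmem hsw⟩, ?_⟩
  simp [Equiv.Perm.mul_apply, s_apply, hD, c]

theorem sum_lastVec {M : Type*} [AddCommMonoid M] (hn : 2 ≤ n) (m : Fin n) (hm : m.val + 1 = n)
    (H : weylD n → M) (K : SignedIdx n → M)
    (h : ∀ u : weylD n, (∀ p ∈ zeroSet (lastVec n), Asc u.1 p) → H u = K (u.1 (m, 1))) :
    ∑ u : weylD n with ∀ p ∈ zeroSet (lastVec n), Asc u.1 p, H u = ∑ y, K y := by
  refine Finset.sum_bij (fun u _ => u.1 (m, 1)) (fun _ _ => Finset.mem_univ _) ?_ ?_ ?_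
  · intro u hu v hv huv
    simp only [Finset.mem_filter, Finset.mem_univ, true_and] at hu hv
    refine dominant_lastVec.eq_of_transport_eq isOdd_lastVec hu hv ?_
    funext x
    rw [transport_lastVec u m hm, transport_lastVec v m hm, huv]
  · intro y _
    obtain ⟨w, hw⟩ := exists_apply_last hn m y
    obtain ⟨u, h1, h2⟩ := exists_transport_eq isOdd_lastVec w
    refine ⟨u, by simpa using h1, ?_⟩
    have h3 := congrFun h2 (w.1 (m, 1))
    rw [transport_lastVec u m hm, transport_lastVec w m hm, if_pos rfl, hw] at h3
    split_ifs at h3 with h4 h5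
    · exact h4.symm
    · norm_num at h3
  · intro u hu
    simp only [Finset.mem_filter, Finset.mem_univ, true_and] at hu
    exact h u hu

theorem snd_eq_one_and_fst_lt {x y : SignedIdx n} (h1 : rho x < rho y) (h2 : rho (neg x) < rho y) :
    y.2 = 1 ∧ x.1 < y.1 := by
  obtain ⟨a, ea⟩ := x
  obtain ⟨b, eb⟩ := y
  simp only [neg] at h2 ⊢
  rw [Fin.lt_def]
  rcases Int.units_eq_one_or ea with rfl | rfl <;>
    rcases Int.units_eq_one_or eb with rfl | rfl <;> simp at h1 h2 ⊢ <;> omega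

/-- Such a `u` places the last index anywhere and maps the others in increasing order of absolute
value, with positive signs except possibly at the index `0`. That one sign is forced by the parity,
and `F 0 = 0` makes it irrelevant. -/
theorem oddExt_inv_apply {u : weylD n} (hu : ∀ p ∈ zeroSet (lastVec n), Asc u.1 p) (m : Fin n)
    (hm : m.val + 1 = n) {F : ℕ → ℚ} (hF : F 0 = 0) (l : Fin n) :
    oddExt n F (u.1⁻¹ (l, 1)) =
      if (u.1 (m, 1)).1 = l then (((u.1 (m, 1)).2 : ℤ) : ℚ) * F (n - 1)
      else if (u.1 (m, 1)).1 < l then F (l.val - 1) else F l.val := by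
  have hs := weylD_isSigned u
  rcases hy : u.1 (m, 1) with ⟨i, δ⟩
  simp only
  have hmv : m.val = n - 1 := by omega
  split_ifs with h1 h2
  · subst h1
    have h3 : u.1⁻¹ (i, 1) = (m, δ) := by
      apply u.1.injective
      have := hs.snd_apply (m, δ)
      have h4 := hs.fst_apply (m, δ)
      rw [hy] at this h4
      rw [perm_apply_inv]
      refine Prod.ext h4.symm ?_
      rw [this]; simp [Int.units_mul_self]
    rw [h3]
    simp [oddExt, hmv]
  all_goals
    set j := (u.1⁻¹ (l, 1)).1 with hj
    have hl : (u.1 (j, 1)).1 = l := by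
      have := hs.fst_apply (u.1⁻¹ (l, 1))
      rw [← hj] at this
      rw [← this]; simp
    have hjm : j ≠ m := by
      intro h
      rw [h, hy] at hl
      exact h1 hl
    have hlast : ∀ k : Fin n, k ≠ m → ∀ e : ℤˣ, lastVec n (k, e) = 0 := fun k hk e =>
      if_neg fun h => hk (Fin.ext (by simp only at h; omega))
    have hlt : ∀ i k : Fin n, i ≠ m → k ≠ m → i < k →
        (u.1 (k, 1)).2 = 1 ∧ (u.1 (i, 1)).1 < (u.1 (k, 1)).1 := by
      intro i k hi hk hik
      have hv : i.val < k.val := hik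
      have key : ∀ e : ℤˣ, rho (u.1 (i, e)) < rho (u.1 (k, 1)) := fun e => by
        refine dominant_lastVec.rho_lt isOdd_lastVec hs (fun q hq => hu q (mem_zeroSet.2 hq))
          hik.ne ?_ (by rw [hlast i hi, hlast k hk])
        rcases Int.units_eq_one_or e with rfl | rfl <;> simp <;> omega
      have k1 := key 1
      have k2 := key (-1)
      rw [show ((i, -1) : SignedIdx n) = neg (i, 1) from rfl, hs] at k2
      exact snd_eq_one_and_fst_lt k1 k2
    have hcard : j.val = (Finset.univ.filter fun k : Fin n => k < l ∧ k ≠ i).card := by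
      rw [← Fin.card_Iio j]
      refine Finset.card_equiv hs.perm fun k => ?_
      rw [Finset.mem_Iio, Finset.mem_filter, hs.perm_apply]
      simp only [Finset.mem_univ, true_and]
      have hk : (u.1 (k, 1)).1 ≠ i ↔ k ≠ m := by
        rw [not_iff_not]
        constructor
        · intro h
          exact (hs.fst_eq_iff (k, 1) (m, 1)).1 (by rw [h, hy])
        · rintro rfl; rw [hy]
      rw [hk]
      constructor
      · intro h
        have hkm : k ≠ m := by
          rintro rfl
          have : k.val < j.val := h
          have := j.2
          omega
        exact ⟨hl ▸ (hlt k j hkm hjm h).2, hkm⟩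
      · rintro ⟨h, hkm⟩
        by_contra hc
        rcases (not_lt.1 hc).lt_or_eq with h' | h'
        · have := (hlt j k hjm hkm h').2
          rw [hl] at this
          exact absurd h this.not_gt
        · subst h'; rw [hl] at h; exact lt_irrefl _ h
    have hval : oddExt n F (u.1⁻¹ (l, 1)) = F j.val := by
      unfold oddExt
      by_cases hj0 : j.val = 0
      · rw [← hj, hj0, hF, mul_zero]
      · have h0 : (⟨0, by omega⟩ : Fin n) < j := Fin.lt_def.2 (by simp only; omega)
        have h0m : (⟨0, by omega⟩ : Fin n) ≠ m := by
          intro h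
          have h5 := congrArg Fin.val h
          simp only at h5
          have := j.2
          have : j.val < m.val ∨ j = m := by
            rcases lt_or_eq_of_le (show j.val ≤ m.val by omega) with h | h
            · exact Or.inl h
            · exact Or.inr (Fin.ext h)
          rcases this with h | h
          · omega
          · exact hjm h
        have h3 := (hlt _ j h0m hjm h0).1
        have h4 := hs.snd_apply (u.1⁻¹ (l, 1))
        rw [← hj, h3, perm_apply_inv] at h4
        rw [← hj, show (u.1⁻¹ (l, 1)).2 = 1 by simpa using h4.symm]
        simp
    rw [hval, hcard]
  · congr 1
    have : (Finset.univ.filter fun k : Fin n => k < l ∧ k ≠ i) = (Finset.Iio l).erase i := by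
      ext k; simp [and_comm]
    rw [this, Finset.card_erase_of_mem (by simpa using h2), Fin.card_Iio]
  · congr 1
    have : (Finset.univ.filter fun k : Fin n => k < l ∧ k ≠ i) = Finset.Iio l := by
      ext k
      simp only [Finset.mem_filter, Finset.mem_univ, true_and, Finset.mem_Iio, and_iff_left_iff_imp]
      rintro h rfl
      exact h2 h
    rw [this, Fin.card_Iio]

/-- The two signs cancel when the last index goes to `±l`. The `2 * l` images of smaller absolute
value shift `l` down by one, and the others leave it in place. -/
theorem act_lastVec (hn : 2 ≤ n) {F : ℕ → ℚ} (hF : F 0 = 0) (l : Fin n) :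
    act n (ascSum (zeroSet (lastVec n))) (oddExt n F) (l, 1) =
      2 * (l.val * F (l.val - 1) + ((n : ℚ) - 1 - l.val) * F l.val) := by
  let m : Fin n := ⟨n - 1, by omega⟩
  have hm : m.val + 1 = n := by simp only [m]; omega
  rw [act_ascSum, sum_lastVec hn m hm _ (fun y => if y.1 = l then ((y.2 : ℤ) : ℚ) * F (n - 1)
      else if y.1 < l then F (l.val - 1) else F l.val)
      fun u hu => oddExt_inv_apply hu m hm hF l]
  have hu : (Finset.univ : Finset ℤˣ) = {1, -1} := rfl
  have hi : ∀ i : Fin n, ∑ e : ℤˣ, (if i = l then ((e : ℤ) : ℚ) * F (n - 1)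
      else if i < l then F (l.val - 1) else F l.val) =
      (if i < l then 2 * F (l.val - 1) else 0) + (if l < i then 2 * F l.val else 0) := by
    intro i
    rw [hu, Finset.sum_pair (by decide)]
    rcases lt_trichotomy i l with h | h | h
    · simp only [h.ne, if_false, h, if_true, h.not_gt]; ring
    · simp [h]
    · simp only [h.ne', if_false, h, if_true, h.not_gt]; ring
  rw [Fintype.sum_prod_type, Finset.sum_congr rfl fun i _ => hi i, Finset.sum_add_distrib,
    ← Finset.sum_filter, ← Finset.sum_filter, Finset.sum_const, Finset.sum_const,
    Finset.filter_gt_eq_Iio, Finset.filter_lt_eq_Ioi, Fin.card_Iio, Fin.card_Ioi]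
  have hl := l.2
  rw [nsmul_eq_mul, nsmul_eq_mul, Nat.cast_sub (by omega), Nat.cast_sub (by omega)]
  push_cast
  ring

end LastVector

end DescentAlg

namespace DescentAlg

/-! ### The diagram automorphism and the radical elements used for the lower bounds. -/

section FixedElements

variable {n : ℕ}

/-- The diagram automorphism on the labels of the simple roots. -/
def flip (p : SimpleIdx n) : SimpleIdx n :=
  ⟨t n p.1, by
    have h1 := p.2.1
    have h2 := p.2.2
    rw [t_apply]
    split_ifs with h
    · exact ⟨h1, Or.inr h⟩
    · exact ⟨h1, h2⟩⟩

theorem t_up (p : SimpleIdx n) : t n (up p) = up p := by simp [t_apply, up]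

theorem up_flip (p : SimpleIdx n) : up (flip p) = up p := by
  have : (flip p).1.1 = p.1.1 := by
    simp only [flip, t_apply]; split_ifs <;> rfl
  simp [up, this]

theorem flip_flip (p : SimpleIdx n) : flip (flip p) = p := by
  apply Subtype.ext
  simp only [flip]
  rw [← Equiv.Perm.mul_apply, t_mul_t]; rfl

theorem asc_sigmaD (w : weylD n) (p : SimpleIdx n) :
    Asc (sigmaD n w).1 p ↔ Asc w.1 (flip p) := by
  simp only [Asc, coe_sigmaD_apply, t_inv, Equiv.Perm.mul_apply, rho_t, t_up, up_flip]
  rfl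

theorem domCongr_ascSum (f : SignedIdx n → ℤ) :
    MonoidAlgebra.domCongr ℚ ℚ (sigmaD n) (ascSum (zeroSet f)) =
      ascSum (zeroSet fun x => f (t n x)) := by
  ext w
  rw [MonoidAlgebra.coeff_domCongr]
  obtain ⟨v, rfl⟩ := (sigmaD n).surjective w
  rw [MulEquiv.symm_apply_apply, ascSum_apply, ascSum_apply]
  refine if_congr ?_ rfl rfl
  simp only [asc_sigmaD, mem_zeroSet, t_up]
  constructor
  · intro h p hp
    exact h (flip p) (by rw [up_flip]; exact hp)
  · intro h p hp
    have := h (flip p) (by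
      rw [up_flip, ← hp]
      exact congrArg f (congrArg Subtype.val (flip_flip p)))
    rwa [flip_flip] at this

theorem domCongr_lastVec (hn : 2 ≤ n) :
    MonoidAlgebra.domCongr ℚ ℚ (sigmaD n) (ascSum (zeroSet (lastVec n))) =
      ascSum (zeroSet (lastVec n)) := by
  rw [domCongr_ascSum]
  congr 2
  funext x
  rw [t_apply]
  split_ifs with h
  · simp only [lastVec]
    rw [if_neg (by omega), if_neg (by omega)]
  · rfl

theorem domCongr_signVec (η : ℤˣ) :
    MonoidAlgebra.domCongr ℚ ℚ (sigmaD n) (ascSum (zeroSet (signVec n η))) =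
      ascSum (zeroSet (signVec n (-η))) := by
  rw [domCongr_ascSum]
  congr 2
  funext x
  rw [t_apply]
  split_ifs with h <;> simp [signVec, headSign, h]

/-- The sum of the elements attached to the vectors `(±1, 1, …, 1)`. -/
noncomputable def signSum (n : ℕ) : MonoidAlgebra ℚ (weylD n) :=
  ascSum (zeroSet (signVec n 1)) + ascSum (zeroSet (signVec n (-1)))

/-- The difference of the elements attached to the vectors `(±1, 1, …, 1)`. -/
noncomputable def signDiff (n : ℕ) : MonoidAlgebra ℚ (weylD n) :=
  ascSum (zeroSet (signVec n 1)) - ascSum (zeroSet (signVec n (-1)))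

/-- The element attached to the vector `(0, …, 0, 1)`. -/
noncomputable def lastElt (n : ℕ) : MonoidAlgebra ℚ (weylD n) := ascSum (zeroSet (lastVec n))

/-- The commutator of `lastElt n` and `signSum n`. -/
noncomputable def lowering (n : ℕ) : MonoidAlgebra ℚ (weylD n) :=
  lastElt n * signSum n - signSum n * lastElt n

theorem signSum_mem : signSum n ∈ descentSpace (gensD n) :=
  add_mem (ascSum_mem_descentSpace _) (ascSum_mem_descentSpace _)

theorem signDiff_mem : signDiff n ∈ descentSpace (gensD n) :=
  sub_mem (ascSum_mem_descentSpace _) (ascSum_mem_descentSpace _)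

theorem lastElt_mem : lastElt n ∈ descentSpace (gensD n) := ascSum_mem_descentSpace _

theorem lowersSpan_lowering : LowersSpan (lowering n) := lowersSpan_commutator lastElt_mem signSum_mem

theorem domCongr_signSum :
    MonoidAlgebra.domCongr ℚ ℚ (sigmaD n) (signSum n) = signSum n := by
  rw [signSum, map_add, domCongr_signVec, domCongr_signVec, neg_neg, add_comm]

theorem domCongr_signDiff :
    MonoidAlgebra.domCongr ℚ ℚ (sigmaD n) (signDiff n) = -signDiff n := by
  rw [signDiff, map_sub, domCongr_signVec, domCongr_signVec, neg_neg, neg_sub]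

theorem lowering_mem_fixed (hn : 2 ≤ n) :
    lowering n ∈ fixedDescentAlgebra (gensD n) (sigmaD n) := by
  have h1 : lastElt n ∈ fixedDescentAlgebra (gensD n) (sigmaD n) :=
    mem_fixedDescentAlgebra_iff.2 ⟨lastElt_mem, domCongr_lastVec hn⟩
  have h2 : signSum n ∈ fixedDescentAlgebra (gensD n) (sigmaD n) :=
    mem_fixedDescentAlgebra_iff.2 ⟨signSum_mem, domCongr_signSum⟩
  exact sub_mem (mul_mem h1 h2) (mul_mem h2 h1)

theorem signDiff_sq_mem_fixed :
    signDiff n * signDiff n ∈ fixedDescentAlgebra (gensD n) (sigmaD n) :=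
  mem_fixedDescentAlgebra_iff.2 ⟨mul_mem_descentSpace signDiff_mem signDiff_mem, by
    rw [map_mul, domCongr_signDiff, neg_mul_neg]⟩

theorem longestA_mul_of_odd (hn : ¬ Even n) (a : MonoidAlgebra ℚ (weylD n)) :
    longestA n * a = MonoidAlgebra.domCongr ℚ ℚ (sigmaD n) a * longestA n := by
  ext w
  rw [longestA, MonoidAlgebra.coeff_single_mul_apply, MonoidAlgebra.coeff_mul_single_apply,
    one_mul, mul_one, longestW_inv, MonoidAlgebra.coeff_domCongr]
  congr 1
  apply (sigmaD n).injective
  rw [MulEquiv.apply_symm_apply, ← mul_right_cancel_iff (a := longestW n),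
    ← longestW_mul_of_odd hn, ← mul_assoc, longestW_mul_self, mul_assoc, longestW_mul_self]
  simp

/-- Conjugation by `w₀` is the diagram automorphism for odd `n`, so `signDiff n` equals `w₀` times
the commutator of `w₀` with the element of `(1, …, 1)`. -/
theorem lowersSpan_signDiff (hn : ¬ Even n) : LowersSpan (signDiff n) := by
  set x := ascSum (zeroSet (signVec n 1))
  have h := (lowersSpan_commutator (longestA_mem (n := n)) (b := x)
    (ascSum_mem_descentSpace _)).mul_left longestA_mem
  have e : longestA n * (longestA n * x - x * longestA n) = signDiff n := by
    rw [mul_sub, ← mul_assoc, longestA_mul_self, one_mul, ← mul_assoc, longestA_mul_of_odd hn,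
      mul_assoc, longestA_mul_self, mul_one, domCongr_signVec]
    rfl
  rwa [e] at h

end FixedElements

/-! ### Binomial vectors and the chain of lowerings. -/

section BinomialVectors

open Polynomial

variable {n : ℕ}

theorem isOdd_act {a : MonoidAlgebra ℚ (weylD n)} (ha : a ∈ descentSpace (gensD n))
    {f : SignedIdx n → ℚ} (hf : IsOdd f) : IsOdd (act n a f) := by
  rw [descentSpace_eq] at ha
  induction ha using Submodule.span_induction with
  | mem x hx => obtain ⟨J, rfl⟩ := hx; exact isOdd_act_ascSum J hf
  | zero => intro x; simp
  | add x y _ _ hx hy => intro z; simp [hx z, hy z, add_comm]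
  | smul c x _ hx => intro z; simp [hx z]

theorem prod_eq_neg_one_iff (g : Fin n → ℤˣ) : ∏ k, g k = -1 ↔ ¬ ∏ k, g k = 1 := by
  rcases Int.units_eq_one_or (∏ k, g k) with h | h <;> simp [h]

theorem act_signSum (hn : 0 < n) {F : ℕ → ℚ} (hF : F 0 = 0) (l : Fin n) :
    act n (signSum n) (oddExt n F) (l, 1) =
      ∑ g : Fin n → ℤˣ, ((g l : ℤ) : ℚ) * F (signRank g l) := by
  rw [signSum, map_add, LinearMap.add_apply, Pi.add_apply, act_signVec hn, act_signVec hn]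
  rw [← Finset.sum_filter_add_sum_filter_not Finset.univ fun g : Fin n → ℤˣ => ∏ k, g k = 1]
  simp only [prod_eq_neg_one_iff]
  congr 1 <;>
  · refine Finset.sum_congr rfl fun g _ => ?_
    split_ifs with h
    · simp [h, hF]
    · ring

theorem act_signDiff (hn : 0 < n) {F : ℕ → ℚ} (hF : F 0 = 0) (l : Fin n) :
    act n (signDiff n) (oddExt n F) (l, 1) =
      ∑ g : Fin n → ℤˣ, ((∏ k, g k : ℤˣ) : ℤ) * ((g l : ℤ) : ℚ) * F (signRank g l) := by
  rw [signDiff, map_sub, LinearMap.sub_apply, Pi.sub_apply, act_signVec hn, act_signVec hn]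
  rw [← Finset.sum_filter_add_sum_filter_not Finset.univ fun g : Fin n → ℤˣ => ∏ k, g k = 1,
    sub_eq_add_neg, ← Finset.sum_neg_distrib]
  simp only [prod_eq_neg_one_iff]
  congr 1
  · refine Finset.sum_congr rfl fun g hg => ?_
    rw [(Finset.mem_filter.1 hg).2]
    split_ifs with h
    · simp [h, hF]
    · simp
  · refine Finset.sum_congr rfl fun g hg => ?_
    rw [(prod_eq_neg_one_iff g).2 (Finset.mem_filter.1 hg).2]
    split_ifs with h
    · simp [h, hF]
    · simp

/-- The odd function whose value at the index `l` is the binomial coefficient of `l` and `k`. -/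
noncomputable def binomVec (n k : ℕ) : SignedIdx n → ℚ := oddExt n fun j => (j.choose k : ℚ)

theorem binomVec_apply (k : ℕ) (l : Fin n) : binomVec n k (l, 1) = (l.val.choose k : ℚ) := by
  simp [binomVec, oddExt]

theorem isOdd_sum_smul (s : Finset ℕ) (c : ℕ → ℚ) : IsOdd (∑ i ∈ s, c i • binomVec n i) := by
  intro x
  have h : ∀ i, binomVec n i (neg x) = -binomVec n i x := fun i => isOdd_oddExt _ x
  simp [Finset.sum_apply, h]

/-- The matrix coefficients of `signSum n` with respect to the vectors `binomVec n k`. -/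
noncomputable def signSumCoeff (n k i : ℕ) : ℚ :=
  (1 - (-1) ^ i) * ((X ^ i * (X + C 2) ^ (n - 1 - i) : ℚ[X]).coeff k)

/-- Writing `2 * (1 + X) = X + (X + 2)` and `2 = -X + (X + 2)`, the two binomial expansions differ
only in their odd terms. -/
theorem pow_sub_pow_eq_sum (l : Fin n) :
    (1 + 1 * (1 + X) : ℚ[X]) ^ (n - 1 - l.val) * (1 + 1) ^ l.val * ((1 + X) ^ l.val + -1) =
      ∑ i ∈ Finset.range n, C ((l.val.choose i : ℚ) * (1 - (-1) ^ i)) *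
        (X ^ i * (X + C 2) ^ (n - 1 - i)) := by
  have hl := l.2
  have h1 : (X + (X + C 2) : ℚ[X]) ^ l.val = (1 + 1) ^ l.val * (1 + X) ^ l.val := by
    rw [← mul_pow]; congr 1; rw [show (C 2 : ℚ[X]) = 2 from rfl]; ring
  have h2 : (-X + (X + C 2) : ℚ[X]) ^ l.val = (1 + 1) ^ l.val := by
    congr 1; rw [show (C 2 : ℚ[X]) = 2 from rfl]; ring
  have h3 : (1 + 1 * (1 + X) : ℚ[X]) = X + C 2 := by
    rw [show (C 2 : ℚ[X]) = 2 from rfl]; ring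
  have hsub : Finset.range (l.val + 1) ⊆ Finset.range n := by
    intro i; simp only [Finset.mem_range]; omega
  rw [← Finset.sum_subset hsub fun i _ hi => by
    rw [Nat.choose_eq_zero_of_lt (by simpa using hi)]; simp]
  have h4 : (1 + 1 : ℚ[X]) ^ l.val * ((1 + X) ^ l.val + -1) =
      (X + (X + C 2)) ^ l.val - (-X + (X + C 2)) ^ l.val := by rw [h1, h2]; ring
  rw [h3, mul_assoc, h4, add_pow X (X + C 2), add_pow (-X) (X + C 2), ← Finset.sum_sub_distrib, Finset.mul_sum]
  refine Finset.sum_congr rfl fun i hi => ?_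
  have hi' : i ≤ l.val := by simpa [Nat.lt_succ_iff] using hi
  rw [show n - 1 - i = (n - 1 - l.val) + (l.val - i) by omega, pow_add, neg_pow (X : ℚ[X]) i]
  simp only [map_mul, map_sub, map_one, map_pow, map_neg, map_natCast]
  ring

theorem act_signSum_binomVec (hn : 0 < n) {k : ℕ} (hk : k ≠ 0) :
    act n (signSum n) (binomVec n k) =
      ∑ i ∈ Finset.range n, signSumCoeff n k i • binomVec n i := by
  refine IsOdd.ext (isOdd_act signSum_mem (isOdd_oddExt _)) (isOdd_sum_smul _ _) fun l => ?_
  rw [binomVec, act_signSum hn (by simp [Nat.choose_eq_zero_of_lt (Nat.pos_of_ne_zero hk)])]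
  -- With `τ = 1 + X`, the coefficient of `X ^ k` in `τ ^ j` is the binomial coefficient of `j` and
  -- `k`.
  have h := sum_signRank (R := ℚ[X]) (fun e => C ((e : ℤ) : ℚ)) (fun _ => 1) (1 + X) l
  simp only [ite_self, Finset.prod_const_one, mul_one, Units.val_one,
    Int.cast_one, map_one, Units.val_neg, Int.cast_neg, map_neg, one_mul] at h
  have h' := pow_sub_pow_eq_sum l
  rw [one_mul] at h'
  rw [h'] at h
  have h2 := congrArg (fun p => coeff p k) h
  simp only [finsetSum_coeff, coeff_C_mul, coeff_one_add_X_pow] at h2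
  rw [h2, Finset.sum_apply]
  refine Finset.sum_congr rfl fun i _ => ?_
  rw [Pi.smul_apply, binomVec_apply, smul_eq_mul, signSumCoeff]
  ring

theorem act_lastElt_binomVec (hn : 2 ≤ n) {k : ℕ} (hk : k ≠ 0) :
    act n (lastElt n) (binomVec n k) = (2 * ((n : ℚ) - 1 - k)) • binomVec n k := by
  have ho : IsOdd ((2 * ((n : ℚ) - 1 - k)) • binomVec n k) := fun x => by
    have h : binomVec n k (neg x) = -binomVec n k x := isOdd_oddExt _ x
    simp [h]
  refine IsOdd.ext (isOdd_act lastElt_mem (isOdd_oddExt _)) ho fun l => ?_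
  rw [Pi.smul_apply, binomVec_apply, smul_eq_mul, lastElt, binomVec,
    act_lastVec hn (by simp [Nat.choose_eq_zero_of_lt (Nat.pos_of_ne_zero hk)])]
  obtain ⟨l, hl⟩ := l
  simp only
  rcases l with _ | l
  · simp [Nat.choose_eq_zero_of_lt (Nat.pos_of_ne_zero hk)]
  · have h : ((l.choose k : ℕ) : ℚ) * (l + 1) = (l + 1).choose k * ((l : ℚ) + 1 - k) := by
      by_cases hkl : k ≤ l + 1
      · have := Nat.choose_mul_succ_eq l k
        have h2 : ((l + 1 - k : ℕ) : ℚ) = (l : ℚ) + 1 - k := by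
          rw [Nat.cast_sub hkl]; push_cast; ring
        rw [← h2]
        exact_mod_cast this
      · rw [Nat.choose_eq_zero_of_lt (by omega : l < k),
          Nat.choose_eq_zero_of_lt (by omega : l + 1 < k)]
        simp
    rw [Nat.add_sub_cancel]
    push_cast
    linear_combination 2 * h

/-- A commutator with a diagonal operator multiplies the matrix entries by differences of
eigenvalues, here `2 * (k - i)`. -/
theorem act_lowering_binomVec (hn : 2 ≤ n) {k : ℕ} (hk : k ≠ 0) :
    act n (lowering n) (binomVec n k) =
      ∑ i ∈ Finset.range n, (signSumCoeff n k i * (2 * ((k : ℚ) - i))) • binomVec n i := by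
  rw [lowering, map_sub, map_mul, map_mul, LinearMap.sub_apply, Module.End.mul_apply,
    Module.End.mul_apply, act_signSum_binomVec (by omega) hk, act_lastElt_binomVec hn hk, map_smul,
    act_signSum_binomVec (by omega) hk, map_sum, Finset.smul_sum, ← Finset.sum_sub_distrib]
  refine Finset.sum_congr rfl fun i _ => ?_
  rw [map_smul]
  by_cases hi : i = 0
  · subst hi; simp [signSumCoeff]
  · rw [act_lastElt_binomVec hn hi, smul_smul, smul_smul, ← sub_smul]
    congr 1
    ring

/-- The span of the vectors `binomVec n i` for odd `i < k`. -/
noncomputable def oddSpan (n k : ℕ) : Submodule ℚ (SignedIdx n → ℚ) :=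
  Submodule.span ℚ (binomVec n '' {i | Odd i ∧ i < k})

theorem oddSpan_mono {j k : ℕ} (h : j ≤ k) : oddSpan n j ≤ oddSpan n k :=
  Submodule.span_mono (Set.image_mono fun _ hi => ⟨hi.1, hi.2.trans_le h⟩)

theorem smul_binomVec_mem {i k : ℕ} (hi : i < k) (m : ℕ) (c : ℚ) :
    (signSumCoeff n m i * c) • binomVec n i ∈ oddSpan n k := by
  rcases Nat.even_or_odd i with h | h
  · simp [signSumCoeff, h.neg_one_pow]
  · exact Submodule.smul_mem _ _ (Submodule.subset_span ⟨i, ⟨h, hi⟩, rfl⟩)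

theorem signSumCoeff_eq_zero {k i : ℕ} (h : k < i) : signSumCoeff n k i = 0 := by
  rw [signSumCoeff, coeff_X_pow_mul', if_neg (by omega), mul_zero]

theorem act_lowering_mem (hn : 2 ≤ n) {k : ℕ} (hk : k ≠ 0) :
    act n (lowering n) (binomVec n k) ∈ oddSpan n k := by
  rw [act_lowering_binomVec hn hk]
  refine Submodule.sum_mem _ fun i _ => ?_
  rcases lt_trichotomy i k with h | rfl | h
  · exact smul_binomVec_mem h _ _
  · simp
  · simp [signSumCoeff_eq_zero h]

theorem signSumCoeff_ne_zero {k : ℕ} (hk : Odd k) (hkn : k + 2 < n) :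
    signSumCoeff n (k + 2) k ≠ 0 := by
  rw [signSumCoeff, add_comm k 2, coeff_X_pow_mul, coeff_X_add_C_pow, hk.neg_one_pow]
  have : (n - 1 - k).choose 2 ≠ 0 := (Nat.choose_pos (by omega)).ne'
  have h2 : ((n - 1 - k).choose 2 : ℚ) ≠ 0 := by exact_mod_cast this
  exact mul_ne_zero (by norm_num) (mul_ne_zero (pow_ne_zero _ two_ne_zero) h2)

theorem act_lowering_sub_mem (hn : 2 ≤ n) {k : ℕ} (hk : Odd k) (hkn : k + 2 < n) :
    act n (lowering n) (binomVec n (k + 2)) - (signSumCoeff n (k + 2) k * 4) • binomVec n k ∈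
      oddSpan n k := by
  rw [act_lowering_binomVec hn (by omega),
    ← Finset.sum_erase_add _ _ (Finset.mem_range.2 (by omega : k < n))]
  have e : (signSumCoeff n (k + 2) k * (2 * (((k + 2 : ℕ) : ℚ) - k))) = signSumCoeff n (k + 2) k * 4 := by
    push_cast; ring
  rw [e, add_sub_cancel_right]
  refine Submodule.sum_mem _ fun i hi => ?_
  rw [Finset.mem_erase] at hi
  rcases lt_trichotomy i k with h | h | h
  · exact smul_binomVec_mem h _ _
  · exact absurd h hi.1
  · by_cases h1 : i = k + 1
    · subst h1
      simp [signSumCoeff, hk.add_one.neg_one_pow]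
    · by_cases h2 : i = k + 2
      · subst h2; simp
      · rw [signSumCoeff_eq_zero (by omega)]; simp

/-- `f` is a nonzero multiple of `binomVec n k` up to lower odd terms. -/
def HasLead (k : ℕ) (f : SignedIdx n → ℚ) : Prop :=
  ∃ c : ℚ, c ≠ 0 ∧ f - c • binomVec n k ∈ oddSpan n k

theorem act_lowering_mem_of_mem (hn : 2 ≤ n) {k : ℕ} {f : SignedIdx n → ℚ}
    (hf : f ∈ oddSpan n (k + 2)) (hk : Odd k) : act n (lowering n) f ∈ oddSpan n k := by
  unfold oddSpan at hf
  induction hf using Submodule.span_induction with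
  | mem x hx =>
    obtain ⟨i, ⟨hi, hik⟩, rfl⟩ := hx
    have hne : i ≠ k + 1 := by
      rintro rfl
      exact (Nat.not_even_iff_odd.2 hi) hk.add_one
    exact oddSpan_mono (by omega) (act_lowering_mem hn hi.pos.ne')
  | zero => simp
  | add x y _ _ hx hy => rw [map_add]; exact add_mem hx hy
  | smul c x _ hx => rw [map_smul]; exact Submodule.smul_mem _ _ hx

theorem HasLead.act_lowering (hn : 2 ≤ n) {k : ℕ} (hk : Odd k) (hkn : k + 2 < n)
    {f : SignedIdx n → ℚ} (hf : HasLead (k + 2) f) : HasLead k (act n (lowering n) f) := by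
  obtain ⟨c, hc, hf⟩ := hf
  refine ⟨c * (signSumCoeff n (k + 2) k * 4),
    mul_ne_zero hc (mul_ne_zero (signSumCoeff_ne_zero hk hkn) (by norm_num)), ?_⟩
  have h1 := act_lowering_mem_of_mem hn hf hk
  have h2 := Submodule.smul_mem _ c (act_lowering_sub_mem hn hk hkn)
  have e : act n (lowering n) f - (c * (signSumCoeff n (k + 2) k * 4)) • binomVec n k =
      act n (lowering n) (f - c • binomVec n (k + 2)) +
        c • (act n (lowering n) (binomVec n (k + 2)) -
          (signSumCoeff n (k + 2) k * 4) • binomVec n k) := by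
    rw [map_sub, map_smul, smul_sub, smul_smul]; abel
  rw [e]
  exact add_mem h1 h2

/-- Each application lowers the odd leading index by two with a nonzero coefficient, ending at a
nonzero multiple of `binomVec n 1`. -/
theorem HasLead.pow_lowering (hn : 2 ≤ n) (m : ℕ) {f : SignedIdx n → ℚ} (hmn : 2 * m + 1 < n)
    (hf : HasLead (2 * m + 1) f) : act n (lowering n ^ m) f ≠ 0 := by
  induction m generalizing f with
  | zero =>
    obtain ⟨c, hc, hf⟩ := hf
    have h0 : oddSpan n 1 = ⊥ := by
      unfold oddSpan
      rw [Submodule.span_eq_bot]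
      rintro _ ⟨i, ⟨hi, hi1⟩, rfl⟩
      exact absurd hi.pos (by omega)
    rw [show 2 * 0 + 1 = 1 from rfl, h0, Submodule.mem_bot, sub_eq_zero] at hf
    intro h
    rw [pow_zero, map_one, Module.End.one_apply, hf] at h
    have := congrFun h (⟨1, by omega⟩, 1)
    rw [Pi.smul_apply, binomVec_apply] at this
    simp [hc] at this
  | succ m ih =>
    rw [pow_succ, map_mul, Module.End.mul_apply]
    exact ih (by omega) (HasLead.act_lowering hn ⟨m, rfl⟩ (by omega) hf)

theorem hasLead_binomVec (k : ℕ) : HasLead k (binomVec n k) := ⟨1, one_ne_zero, by simp⟩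

end BinomialVectors

end DescentAlg

namespace DescentAlg

/-! ### Two further radical factors for odd `n`. -/

section OddCase

variable {n : ℕ}

theorem sum_one_sub_neg_one_pow_mul_choose (l : Fin n) :
    ∑ i ∈ Finset.range n, (1 - (-1 : ℚ) ^ i) * (l.val.choose i : ℚ) = 2 ^ l.val * (1 - 0 ^ l.val) := by
  have hsub : Finset.range (l.val + 1) ⊆ Finset.range n := by
    intro i; have := l.2; simp only [Finset.mem_range]; omega
  rw [← Finset.sum_subset hsub fun i _ hi => by
    rw [Nat.choose_eq_zero_of_lt (by simpa using hi)]; simp]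
  have h1 := add_pow (1 : ℚ) 1 l.val
  have h2 := add_pow (-1 : ℚ) 1 l.val
  simp only [one_pow, one_mul, mul_one] at h1 h2
  simp only [sub_mul, one_mul, Finset.sum_sub_distrib]
  rw [← h1, ← h2]
  rcases Nat.eq_zero_or_pos l.val with h | h
  · simp [h]
  · rw [show (-1 + 1 : ℚ) = 0 by norm_num, zero_pow h.ne']; norm_num

/-- The odd function that is the indicator function of the index `0`. -/
noncomputable def headVec (n : ℕ) : SignedIdx n → ℚ := oddExt n fun j => 0 ^ j

/-- Only rank `0` contributes, and there the factor `η` in `act_signVec` cancels the minus sign of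
the difference. What remains is the unrestricted sum over all signs, that is `sum_signRank` at `τ =
0`. -/
theorem act_signDiff_headVec (hn : 0 < n) :
    act n (signDiff n) (headVec n) =
      ∑ i ∈ Finset.range n, (-(1 - (-1 : ℚ) ^ i)) • binomVec n i := by
  refine IsOdd.ext (isOdd_act signDiff_mem (isOdd_oddExt _)) (isOdd_sum_smul _ _) fun l => ?_
  have h := sum_signRank (R := ℚ) (fun e => ((e : ℤ) : ℚ)) (fun _ => 1) 0 l
  simp only [ite_self, Finset.prod_const_one, mul_one, Units.val_one, Int.cast_one, Units.val_neg,
    Int.cast_neg, one_mul, add_zero, one_pow] at h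
  have hs : act n (signDiff n) (headVec n) (l, 1) =
      ∑ g : Fin n → ℤˣ, ((g l : ℤ) : ℚ) * 0 ^ signRank g l := by
    rw [signDiff, map_sub, LinearMap.sub_apply, Pi.sub_apply, headVec, act_signVec hn,
      act_signVec hn, ← Finset.sum_filter_add_sum_filter_not Finset.univ
        fun g : Fin n → ℤˣ => ∏ k, g k = 1, sub_eq_add_neg, ← Finset.sum_neg_distrib]
    simp only [prod_eq_neg_one_iff]
    congr 1 <;>
    · refine Finset.sum_congr rfl fun g _ => ?_
      split_ifs with h
      · simp [h]
      · simp [h]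
  rw [hs, h, Finset.sum_apply]
  simp only [Pi.smul_apply, binomVec_apply, smul_eq_mul, neg_mul, Finset.sum_neg_distrib]
  rw [sum_one_sub_neg_one_pow_mul_choose, show (1 + 1 : ℚ) = 2 by norm_num]
  ring

theorem hasLead_act_signDiff_headVec (hn : 3 ≤ n) (ho : Odd n) :
    HasLead (n - 2) (act n (signDiff n) (headVec n)) := by
  have h2 : Odd (n - 2) := by
    obtain ⟨k, rfl⟩ := ho
    exact ⟨k - 1, by omega⟩
  refine ⟨-2, by norm_num, ?_⟩
  rw [act_signDiff_headVec (by omega),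
    ← Finset.sum_erase_add _ _ (Finset.mem_range.2 (by omega : n - 2 < n)), h2.neg_one_pow,
    show (-(1 - -1) : ℚ) = -2 by norm_num, add_sub_cancel_right]
  refine Submodule.sum_mem _ fun i hi => ?_
  rw [Finset.mem_erase, Finset.mem_range] at hi
  rcases Nat.even_or_odd i with h | h
  · simp [h.neg_one_pow]
  · have : i ≠ n - 1 := by
      rintro rfl
      exact (Nat.not_even_iff_odd.2 h) (Nat.Odd.sub_odd ho odd_one)
    exact Submodule.smul_mem _ _ (Submodule.subset_span ⟨i, ⟨h, by omega⟩, rfl⟩)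

/-- The odd function with value `0` at the index `0` and `3 ^ j` at the index `j > 0`. -/
noncomputable def geomVec (n : ℕ) : SignedIdx n → ℚ := oddExt n fun j => 3 ^ j - 0 ^ j

/-- Weighting by the product of all signs makes `χ 1 + χ (-1) = 0`, so `sum_signRank` vanishes
unless `l = 0`. With `τ` in place of `3` the factor would be `2 * ((1 - τ) ^ (n - 1) - 1)`; for odd
`n` this is zero at `τ = 2`, which explains the base `3`. -/
theorem act_signDiff_geomVec (hn : 0 < n) :
    act n (signDiff n) (geomVec n) = (2 * ((-2) ^ (n - 1) - 1) : ℚ) • headVec n := by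
  have ho : IsOdd ((2 * ((-2) ^ (n - 1) - 1) : ℚ) • headVec n) := fun x => by
    have h : headVec n (neg x) = -headVec n x := isOdd_oddExt _ x
    simp [h]
  refine IsOdd.ext (isOdd_act signDiff_mem (isOdd_oddExt _)) ho fun l => ?_
  rw [geomVec, act_signDiff hn (by simp)]
  have key : ∀ g : Fin n → ℤˣ, (((∏ k, g k : ℤˣ) : ℤ) : ℚ) * ((g l : ℤ) : ℚ) =
      ∏ k, if k = l then 1 else ((g k : ℤ) : ℚ) := by
    intro g
    have hsq : ((g l : ℤ) : ℚ) * ((g l : ℤ) : ℚ) = 1 := by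
      rcases Int.units_eq_one_or (g l) with h | h <;> simp [h]
    have h1 := Finset.prod_erase_mul Finset.univ (fun k => ((g k : ℤ) : ℚ)) (Finset.mem_univ l)
    have h2 := Finset.prod_erase_mul Finset.univ
      (fun k => if k = l then 1 else ((g k : ℤ) : ℚ)) (Finset.mem_univ l)
    rw [if_pos rfl, mul_one] at h2
    rw [← h2, Units.coe_prod, Int.cast_prod, ← h1, mul_assoc, hsq, mul_one]
    refine Finset.prod_congr rfl fun k hk => ?_
    rw [if_neg (Finset.ne_of_mem_erase hk)]
  have h3 := sum_signRank (R := ℚ) (fun _ => 1) (fun e => ((e : ℤ) : ℚ)) 3 l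
  have h0 := sum_signRank (R := ℚ) (fun _ => 1) (fun e => ((e : ℤ) : ℚ)) 0 l
  simp only [one_mul, Units.val_one, Int.cast_one, Units.val_neg, Int.cast_neg] at h3 h0
  simp only [key, mul_sub, Finset.sum_sub_distrib]
  rw [h3, h0, Pi.smul_apply, headVec, oddExt, smul_eq_mul]
  simp only [Units.val_one, Int.cast_one, one_mul]
  rcases Nat.eq_zero_or_pos l.val with h | h
  · simp only [h]; norm_num; ring
  · rw [show (1 + -1 : ℚ) = 0 by norm_num, zero_pow h.ne']; ring

theorem act_lowering_pow_mul_ne_zero (hn : 3 ≤ n) (ho : Odd n) :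
    act n (lowering n ^ ((n - 3) / 2) * (signDiff n * signDiff n)) (geomVec n) ≠ 0 := by
  have hm : 2 * ((n - 3) / 2) + 1 = n - 2 := by
    obtain ⟨k, rfl⟩ := ho
    omega
  rw [map_mul, map_mul, Module.End.mul_apply, Module.End.mul_apply,
    act_signDiff_geomVec (by omega), map_smul, map_smul]
  refine smul_ne_zero (mul_ne_zero two_ne_zero ?_)
    (HasLead.pow_lowering (by omega) _ (by omega) (hm ▸ hasLead_act_signDiff_headVec hn ho))
  have he : Even (n - 1) := Nat.Odd.sub_odd ho odd_one
  rw [he.neg_pow]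
  have : (1 : ℚ) < 2 ^ (n - 1) := one_lt_pow₀ (by norm_num) (by omega)
  exact sub_ne_zero.2 this.ne'

end OddCase

/-! ### Loewy lengths. -/

section Loewy

variable {n : ℕ} {B : Subalgebra ℚ (MonoidAlgebra ℚ (weylD n))}

theorem jacobson_pow_ne_bot {m : ℕ} {b : B} (hb : b ∈ Ring.jacobson B ^ m)
    {f : SignedIdx n → ℚ} (hf : act n b.1 f ≠ 0) : Ring.jacobson B ^ m ≠ ⊥ := by
  intro h
  rw [h, Ideal.mem_bot] at hb
  simp [hb] at hf

theorem pow_mem_ideal_pow {A : Type*} [Ring A] {J : Ideal A} {a : A} (h : a ∈ J) (m : ℕ) :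
    a ^ m ∈ J ^ m := by
  induction m with
  | zero => rw [pow_zero, Submodule.pow_zero, Ideal.one_eq_top]; trivial
  | succ m ih => rw [_root_.pow_succ, Submodule.pow_succ]; exact Ideal.mul_mem_mul ih h

theorem mul_mem_ideal_pow {A : Type*} [Ring A] {J : Ideal A} {a b : A} {m : ℕ} (ha : a ∈ J ^ m)
    (hb : b ∈ J) : a * b ∈ J ^ (m + 1) := by
  rw [Submodule.pow_succ]
  exact Ideal.mul_mem_mul ha hb

theorem mem_jacobson_of_lowersSpan (hB : B ≤ descentAlgebra (gensD n))
    {a : MonoidAlgebra ℚ (weylD n)} (ha : a ∈ B) (hl : LowersSpan a) :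
    (⟨a, ha⟩ : B) ∈ Ring.jacobson B :=
  (mem_jacobson_iff hB _).2 hl

theorem lowering_pow_mem (hB : B ≤ descentAlgebra (gensD n)) (h : lowering n ∈ B) (m : ℕ) :
    (⟨lowering n, h⟩ : B) ^ m ∈ Ring.jacobson B ^ m :=
  pow_mem_ideal_pow (mem_jacobson_of_lowersSpan hB h lowersSpan_lowering) m

theorem jacobson_pow_ne_bot_of_even (hn : 2 ≤ n) (he : Even n)
    (hB : B ≤ descentAlgebra (gensD n)) (h : lowering n ∈ B) :
    Ring.jacobson B ^ (n / 2 - 1) ≠ ⊥ := by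
  refine jacobson_pow_ne_bot (lowering_pow_mem hB h _) (f := binomVec n (2 * (n / 2 - 1) + 1)) ?_
  exact HasLead.pow_lowering hn _ (by obtain ⟨k, rfl⟩ := he; omega) (hasLead_binomVec _)

theorem lt_of_jacobson_pow_eq_bot {k m : ℕ} (hm : Ring.jacobson B ^ m ≠ ⊥)
    (hk : Ring.jacobson B ^ k = ⊥) : m < k := by
  by_contra h
  exact hm (eq_bot_iff.2 ((Ideal.pow_le_pow_right (not_lt.1 h)).trans hk.le))

theorem loewyLength_eq {k : ℕ} (hk : 1 ≤ k) (h1 : Ring.jacobson B ^ k = ⊥)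
    (h2 : ∀ j, 1 ≤ j → Ring.jacobson B ^ j = ⊥ → k ≤ j) : loewyLength B = k :=
  le_antisymm (Nat.sInf_le ⟨hk, h1⟩) (le_csInf ⟨k, hk, h1⟩ fun j hj => h2 j hj.1 hj.2)

theorem fixedDescentAlgebra_le :
    fixedDescentAlgebra (gensD n) (sigmaD n) ≤ descentAlgebra (gensD n) := inf_le_left

theorem loewyLength_descentAlgebra_of_even (hn : 3 ≤ n) (he : Even n) :
    loewyLength (descentAlgebra (gensD n)) = n / 2 := by
  have e : (n + 1) / 2 = n / 2 := by obtain ⟨k, rfl⟩ := he; omega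
  refine loewyLength_eq (by omega) ?_ fun j _ hj => ?_
  · rw [← e]
    exact jacobson_pow_eq_bot (by omega) le_rfl fun b _ => longestA_mul_of_even he b
  · have := lt_of_jacobson_pow_eq_bot (jacobson_pow_ne_bot_of_even (by omega) he le_rfl
      (fixedDescentAlgebra_le (lowering_mem_fixed (by omega)))) hj
    omega

theorem jacobson_pow_ne_bot_of_odd (hn : 3 ≤ n) (ho : Odd n) :
    Ring.jacobson (descentAlgebra (gensD n)) ^ ((n - 3) / 2 + 2) ≠ ⊥ := by
  have hl : lowering n ∈ descentAlgebra (gensD n) :=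
    fixedDescentAlgebra_le (lowering_mem_fixed (by omega))
  have hd : signDiff n ∈ descentAlgebra (gensD n) := mem_descentAlgebra_iff.2 signDiff_mem
  have hj : (⟨signDiff n, hd⟩ : descentAlgebra (gensD n)) ∈ Ring.jacobson _ :=
    mem_jacobson_of_lowersSpan le_rfl hd (lowersSpan_signDiff (Nat.not_even_iff_odd.2 ho))
  have h := mul_mem_ideal_pow (mul_mem_ideal_pow (lowering_pow_mem le_rfl hl ((n - 3) / 2)) hj) hj
  rw [mul_assoc] at h
  exact jacobson_pow_ne_bot h (act_lowering_pow_mul_ne_zero hn ho)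

/-- The automorphism negates `signDiff n`, so only its square is available in the fixed subalgebra,
as a single radical factor. -/
theorem jacobson_fixed_pow_ne_bot_of_odd (hn : 3 ≤ n) (ho : Odd n) :
    Ring.jacobson (fixedDescentAlgebra (gensD n) (sigmaD n)) ^ ((n - 3) / 2 + 1) ≠ ⊥ := by
  have hl := lowering_mem_fixed (n := n) (by omega)
  have hj := mem_jacobson_of_lowersSpan fixedDescentAlgebra_le (signDiff_sq_mem_fixed (n := n))
    ((lowersSpan_signDiff (Nat.not_even_iff_odd.2 ho)).mul_left signDiff_mem)
  exact jacobson_pow_ne_bot (mul_mem_ideal_pow (lowering_pow_mem fixedDescentAlgebra_le hl _) hj)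
    (act_lowering_pow_mul_ne_zero hn ho)

theorem loewyLength_fixedDescentAlgebra (hn : 1 ≤ n) :
    loewyLength (fixedDescentAlgebra (gensD n) (sigmaD n)) = (n + 1) / 2 := by
  refine loewyLength_eq (by omega) (jacobson_pow_eq_bot hn fixedDescentAlgebra_le
    fun b hb => longestA_mul_of_mem_fixed hb) fun j hj h => ?_
  rcases Nat.even_or_odd n with he | ho
  · have h2 : 2 ≤ n := by obtain ⟨k, rfl⟩ := he; omega
    have := lt_of_jacobson_pow_eq_bot (jacobson_pow_ne_bot_of_even h2 he fixedDescentAlgebra_le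
      (lowering_mem_fixed h2)) h
    obtain ⟨k, rfl⟩ := he
    omega
  · by_cases h1 : n = 1
    · omega
    · have h3 : 3 ≤ n := by obtain ⟨k, rfl⟩ := ho; omega
      have := lt_of_jacobson_pow_eq_bot (jacobson_fixed_pow_ne_bot_of_odd h3 ho) h
      obtain ⟨k, rfl⟩ := ho
      omega

theorem le_loewyLength_of_odd (hn : 3 ≤ n) (ho : Odd n) :
    (n + 3) / 2 ≤ loewyLength (descentAlgebra (gensD n)) := by
  have : IsArtinianRing (descentAlgebra (gensD n)) := IsArtinianRing.of_finite ℚ _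
  -- Nilpotency is needed because the infimum of an empty set of exponents would be `0`.
  obtain ⟨k, hk⟩ := IsArtinianRing.isNilpotent_jacobson_bot (R := descentAlgebra (gensD n))
  have hk' : Ring.jacobson (descentAlgebra (gensD n)) ^ k = ⊥ := by
    rw [Ideal.jacobson_bot] at hk
    exact hk
  have hk0 := lt_of_jacobson_pow_eq_bot (jacobson_pow_ne_bot_of_odd hn ho) hk'
  refine le_csInf ⟨k, by omega, hk'⟩ fun j hj => ?_
  have := lt_of_jacobson_pow_eq_bot (jacobson_pow_ne_bot_of_odd hn ho) hj.2
  obtain ⟨i, rfl⟩ := ho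
  omega

theorem ceil_half (n : ℕ) : ⌈(n : ℚ) / 2⌉₊ = (n + 1) / 2 := by
  rcases Nat.even_or_odd' n with ⟨k, rfl | rfl⟩
  · rw [show (2 * k + 1) / 2 = k by omega]
    push_cast
    rw [mul_div_cancel_left₀ _ (by norm_num : (2 : ℚ) ≠ 0), Nat.ceil_natCast]
  · rw [show (2 * k + 1 + 1) / 2 = k + 1 by omega, Nat.ceil_eq_iff (by omega)]
    push_cast
    constructor <;> linarith

end Loewy

end DescentAlg

theorem mainTheorem4 :
    (∀ n : ℕ, 1 ≤ n →
      Subalgebra.toSubmodule (DescentAlg.descentAlgebra (DescentAlg.gensD n)) =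
        DescentAlg.descentSpace (DescentAlg.gensD n)) ∧
    (∀ n : ℕ, 3 ≤ n → Even n →
      DescentAlg.loewyLength (DescentAlg.descentAlgebra (DescentAlg.gensD n)) = n / 2) ∧
    (∀ n : ℕ, 3 ≤ n → Odd n →
      ((n : ℚ) + 3) / 2 ≤
        (DescentAlg.loewyLength (DescentAlg.descentAlgebra (DescentAlg.gensD n)) : ℚ)) ∧
    (∀ n : ℕ, 1 ≤ n →
      DescentAlg.loewyLength
          (DescentAlg.fixedDescentAlgebra (DescentAlg.gensD n) (DescentAlg.sigmaD n)) =
        ⌈(n : ℚ) / 2⌉₊) := by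
  refine ⟨fun n _ => DescentAlg.toSubmodule_descentAlgebra,
    fun n hn he => DescentAlg.loewyLength_descentAlgebra_of_even hn he, fun n hn ho => ?_,
    fun n hn => by rw [DescentAlg.ceil_half, DescentAlg.loewyLength_fixedDescentAlgebra hn]⟩
  have h := DescentAlg.le_loewyLength_of_odd hn ho
  obtain ⟨k, rfl⟩ := ho
  rw [show (2 * k + 1 + 3) / 2 = k + 2 by omega] at h
  have h' : ((k + 2 : ℕ) : ℚ) ≤ _ := Nat.cast_le.2 h
  refine le_trans (le_of_eq ?_) h'
  push_cast
  ring
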